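/- For $n,p\in\mathbb N$, $A\in\mathbb R^{n\times n}$, $C\in\mathbb R^{p\times n}$, write $(A,C)$ for the system $\dot x(t)=Ax(t)$, $w(t)=Cx(t)$, $t\ge 0$. Systems $(A_1,C_1)$ and $(A_2,C_2)$ of the same sizes $n,p$ are called topologically equivalent if there is a homeomorphism $H:\mathbb R^n\to\mathbb R^n$ such that, whenever $x(t)$ is a solution of the first system with observation $w(t)$, $H(x(t))$ is a solution of the second system with the same observation $w(t)$, and, whenever $y(t)$ is a solution of the second system with observation $z(t)$, $H^{-1}(y(t))$ is a solution of the first system with the same observation $z(t)$. Let $k_{obs}(A,C)$ be the rank of the matrix with block rows $C, CA,\dots,CA^{n-1}$. For every $(A,C)$ there is a nonsingular matrix $P\in\mathbb R^{n\times n}$ with $$P^{-1}AP=\begin{bmatrix}A^0&0&0\\0&A^+&0\\0&0&A^-\end{bmatrix},\qquad CP=\begin{bmatrix}C^0&C^+&C^-\end{bmatrix},$$ where all eigenvalues of $A^0$, $A^+$, $A^-$ have zero, positive, negative real part respectively (blocks of size zero are allowed). Let $n^0(A),n^+(A),n^-(A)$ be the sizes of $A^0,A^+,A^-$, and let $k^0_{obs}(A,C)=k_{obs}(A^0,C^0)$,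 $k^+_{obs}(A,C)=k_{obs}(A^+,C^+)$, $k^-_{obs}(A,C)=k_{obs}(A^-,C^-)$, where the observability matrix of each block is formed with its own size in place of $n$ (and $k_{obs}=0$ for a block of size zero); these six numbers do not depend on the choice of $P$. If $(A_1,C_1)$ and $(A_2,C_2)$ are topologically equivalent, then $$n^0(A_1)=n^0(A_2),\quad n^+(A_1)=n^+(A_2),\quad n^-(A_1)=n^-(A_2),\quad k_{obs}(A_1,C_1)=k_{obs}(A_2,C_2),$$ $$k^0_{obs}(A_1,C_1)=k^0_{obs}(A_2,C_2),\quad k^+_{obs}(A_1,C_1)=k^+_{obs}(A_2,C_2),\quad k^-_{obs}(A_1,C_1)=k^-_{obs}(A_2,C_2).$$ In particular, $(A_1,C_1)$ is completely observable (i.e. $k_{obs}(A_1,C_1)=n$) if and only if $(A_2,C_2)$ is, and $(A_1,C_1)$ is stable (i.e. $n^-(A_1)=n$) if and only if $(A_2,C_2)$ is. -/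

import Mathlib

namespace ObservedODE

open Matrix

/-- `(x, w)` is a state/observation pair of the system `(A, C)`:
`x' (t) = A x(t)` and `w(t) = C x(t)` for all `t ≥ 0` (one-sided derivative at `t = 0`). -/
def IsTrajectory {n p : ℕ} (A : Matrix (Fin n) (Fin n) ℝ) (C : Matrix (Fin p) (Fin n) ℝ)
    (x : ℝ → Fin n → ℝ) (w : ℝ → Fin p → ℝ) : Prop :=
  (∀ t ∈ Set.Ici (0 : ℝ), HasDerivWithinAt x (A *ᵥ x t) (Set.Ici 0) t) ∧
    ∀ t ∈ Set.Ici (0 : ℝ), w t = C *ᵥ x t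

/-- The transformation `(y(t), z(t)) = (H(x(t)), w(t))` brings `(A₁, C₁)` to `(A₂, C₂)`. -/
def Brings {n p : ℕ} (H : (Fin n → ℝ) → (Fin n → ℝ))
    (A₁ : Matrix (Fin n) (Fin n) ℝ) (C₁ : Matrix (Fin p) (Fin n) ℝ)
    (A₂ : Matrix (Fin n) (Fin n) ℝ) (C₂ : Matrix (Fin p) (Fin n) ℝ) : Prop :=
  ∀ x w, IsTrajectory A₁ C₁ x w → IsTrajectory A₂ C₂ (fun t => H (x t)) w

/-- Topological equivalence of the systems `(A₁, C₁)` and `(A₂, C₂)`. -/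
def TopologicallyEquivalent {n p : ℕ}
    (A₁ : Matrix (Fin n) (Fin n) ℝ) (C₁ : Matrix (Fin p) (Fin n) ℝ)
    (A₂ : Matrix (Fin n) (Fin n) ℝ) (C₂ : Matrix (Fin p) (Fin n) ℝ) : Prop :=
  ∃ H : (Fin n → ℝ) ≃ₜ (Fin n → ℝ), Brings H A₁ C₁ A₂ C₂ ∧ Brings H.symm A₂ C₂ A₁ C₁

/-- The Kalman observability matrix, with block rows `C, C A, …, C A ^ (n - 1)`. -/
def obsMatrix {n p : ℕ} (A : Matrix (Fin n) (Fin n) ℝ) (C : Matrix (Fin p) (Fin n) ℝ) :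
    Matrix (Fin n × Fin p) (Fin n) ℝ :=
  Matrix.of fun i j => (C * A ^ (i.1 : ℕ)) i.2 j

/-- The Kalman rank of observability. -/
noncomputable def kObs {n p : ℕ} (A : Matrix (Fin n) (Fin n) ℝ)
    (C : Matrix (Fin p) (Fin n) ℝ) : ℕ :=
  (obsMatrix A C).rank

/-- The complex eigenvalues of a real square matrix. -/
def eigenvalues {n : ℕ} (A : Matrix (Fin n) (Fin n) ℝ) : Set ℂ :=
  spectrum ℂ (A.map (algebraMap ℝ ℂ))

/-- A nonsingular matrix `P` (with inverse `Q`) that transforms the system `(A, C)` into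
`(diag(A⁰, A⁺, A⁻), [C⁰ C⁺ C⁻])`, i.e. `P⁻¹ A P = diag(A⁰, A⁺, A⁻)` and `C P = [C⁰ C⁺ C⁻]`,
where the eigenvalues of `A⁰`, `A⁺`, `A⁻` have zero, positive and negative real parts
respectively. Blocks of size zero are allowed. -/
structure SpectralForm {n p : ℕ} (A : Matrix (Fin n) (Fin n) ℝ)
    (C : Matrix (Fin p) (Fin n) ℝ) where
  /-- the dimension of `A⁰` -/
  nZero : ℕ
  /-- the dimension of `A⁺` -/
  nPlus : ℕ
  /-- the dimension of `A⁻` -/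
  nMinus : ℕ
  AZero : Matrix (Fin nZero) (Fin nZero) ℝ
  APlus : Matrix (Fin nPlus) (Fin nPlus) ℝ
  AMinus : Matrix (Fin nMinus) (Fin nMinus) ℝ
  CZero : Matrix (Fin p) (Fin nZero) ℝ
  CPlus : Matrix (Fin p) (Fin nPlus) ℝ
  CMinus : Matrix (Fin p) (Fin nMinus) ℝ
  P : Matrix (Fin n) (Fin nZero ⊕ (Fin nPlus ⊕ Fin nMinus)) ℝ
  Q : Matrix (Fin nZero ⊕ (Fin nPlus ⊕ Fin nMinus)) (Fin n) ℝ
  mul_inv : P * Q = 1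
  inv_mul : Q * P = 1
  conj_eq : Q * A * P = fromBlocks AZero 0 0 (fromBlocks APlus 0 0 AMinus)
  obs_eq : C * P = fromCols CZero (fromCols CPlus CMinus)
  re_zero : ∀ μ ∈ eigenvalues AZero, μ.re = 0
  re_pos : ∀ μ ∈ eigenvalues APlus, 0 < μ.re
  re_neg : ∀ μ ∈ eigenvalues AMinus, μ.re < 0

namespace SpectralForm

variable {n p : ℕ} {A : Matrix (Fin n) (Fin n) ℝ} {C : Matrix (Fin p) (Fin n) ℝ}

/-- The Kalman rank of the subsystem `(A⁰, C⁰)`. -/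
noncomputable def kObsZero (D : SpectralForm A C) : ℕ := kObs D.AZero D.CZero

/-- The Kalman rank of the subsystem `(A⁺, C⁺)`. -/
noncomputable def kObsPlus (D : SpectralForm A C) : ℕ := kObs D.APlus D.CPlus

/-- The Kalman rank of the subsystem `(A⁻, C⁻)`. -/
noncomputable def kObsMinus (D : SpectralForm A C) : ℕ := kObs D.AMinus D.CMinus

end SpectralForm

/-- The system is completely observable: its Kalman rank is `n`. -/
def IsObservable {n p : ℕ} (A : Matrix (Fin n) (Fin n) ℝ) (C : Matrix (Fin p) (Fin n) ℝ) :
    Prop :=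
  kObs A C = n

/-- The system is stable: `n⁻(A) = n`. -/
def IsStable {n p : ℕ} (A : Matrix (Fin n) (Fin n) ℝ) (C : Matrix (Fin p) (Fin n) ℝ) : Prop :=
  ∃ D : SpectralForm A C, D.nMinus = n

end ObservedODE

/-! Uniqueness of solutions shows that `H` intertwines the flows and matches the observations. `H 0`
is an equilibrium of the second system with zero observation, so translating by `-H 0` gives a
homeomorphism that fixes the origin and keeps both properties
(`TopologicallyEquivalent.exists_homeomorph`).

Such a homeomorphism preserves every subspace described by orbits and observations: the points whose
orbit tends to 0 in forward time, those whose orbit does so in backward time, the points whose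
observation vanishes identically, and the intersections of the first two with the third. By
invariance of dimension, proved here from a no-retraction theorem, their dimensions agree
(`TopologicallyEquivalent.finrank_eq`).

Linear algebra turns these dimensions into the invariants. The stable subspaces of `A` and `-A` are
the negative and positive spectral blocks (`SpectralForm.finrank_stableSubspace`), and the rank of
observability is the codimension of the unobservable subspace (`kObs_add_finrank_unobservable`). The
central block has no dynamical description here. Its size and rank come by subtraction, because the
unobservable subspace splits along the spectral blocks (`SpectralForm.finrank_unobservable`). -/

/-! ### Invariance of dimension, by a volume argument. -/

section InvarianceOfDimension

open MeasureTheory Set Metric Polynomial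

open scoped Topology NNReal

section Topology

variable {E F : Type*} [NormedAddCommGroup E] [NormedAddCommGroup F]

/-- Extending by zero a Lipschitz function that vanishes on the boundary of a ball. -/
theorem lipschitzWith_indicator_closedBall [NormedSpace ℝ E] {φ : E → F} {K : ℝ≥0} {r : ℝ}
    (hφ : LipschitzOnWith K φ (closedBall 0 r)) (h0 : ∀ x, ‖x‖ = r → φ x = 0) :
    LipschitzWith K ((closedBall 0 r).indicator φ) := by
  have key : ∀ x y : E, ‖x‖ ≤ r → r < ‖y‖ → ‖φ x‖ ≤ K * ‖x - y‖ := by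
    intro x y hx hy
    have hcont : ContinuousOn (fun s : ℝ => ‖x + s • (y - x)‖) (Icc 0 1) := by fun_prop
    -- The segment from `x` inside to `y` outside meets the sphere, where `φ` vanishes; the
    -- Lipschitz bound is applied up to that point.
    obtain ⟨s, hs, hsr⟩ := intermediate_value_Icc (zero_le_one' ℝ) hcont
      (show r ∈ Icc _ _ by simp [hx, hy.le])
    simp only at hsr
    have h1 := hφ.dist_le_mul x (by simpa using hx) (x + s • (y - x)) (by simp [hsr])
    rw [h0 _ hsr, dist_zero_right, dist_eq_norm, sub_add_cancel_left, norm_neg, norm_smul,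
      Real.norm_of_nonneg hs.1, norm_sub_rev] at h1
    refine h1.trans (mul_le_mul_of_nonneg_left ?_ K.2)
    exact mul_le_of_le_one_left (norm_nonneg _) hs.2
  refine LipschitzWith.of_dist_le_mul fun x y => ?_
  by_cases hx : x ∈ closedBall (0 : E) r <;> by_cases hy : y ∈ closedBall (0 : E) r
  · simpa [indicator_of_mem hx, indicator_of_mem hy] using hφ.dist_le_mul x hx y hy
  · rw [indicator_of_mem hx, indicator_of_notMem hy, dist_zero_right, dist_eq_norm]
    exact key x y (by simpa using hx) (by simpa using hy)
  · rw [indicator_of_notMem hx, indicator_of_mem hy, dist_zero_left, dist_comm, dist_eq_norm]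
    exact key y x (by simpa using hy) (by simpa using hx)
  · rw [indicator_of_notMem hx, indicator_of_notMem hy, dist_self]
    positivity

theorem bijective_id_add_of_lipschitzWith [NormedSpace ℝ E] [CompleteSpace E] {ψ : E → E}
    {K : ℝ≥0} (hψ : LipschitzWith K ψ) (hK : K < 1) :
    Function.Bijective fun x => x + ψ x := by
  rcases subsingleton_or_nontrivial E with hE | hE
  · exact ⟨fun _ _ _ => Subsingleton.elim _ _, fun y => ⟨y, Subsingleton.elim _ _⟩⟩
  have h : ApproximatesLinearOn (fun x => x + ψ x)
      ((ContinuousLinearEquiv.refl ℝ E : E ≃L[ℝ] E) : E →L[ℝ] E) univ K := by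
    intro x _ y _
    have := hψ.dist_le_mul x y
    rw [dist_eq_norm, dist_eq_norm] at this
    convert! this using 2
    simp only [ContinuousLinearEquiv.coe_coe, ContinuousLinearEquiv.refl_apply]
    abel
  have hc : Subsingleton E ∨
      K < ‖((ContinuousLinearEquiv.refl ℝ E).symm : E →L[ℝ] E)‖₊⁻¹ := by
    right
    simpa using hK
  exact (h.toHomeomorph _ hc).bijective

/-- `det (1 + M)` is a fixed affine combination of the values `det (1 + t • M)` at small `t`. -/
theorem exists_det_one_add_eq_sum (n : ℕ) {t₀ : ℝ} (ht₀ : 0 < t₀) :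
    ∃ v w : Fin (n + 1) → ℝ, (∀ i, v i ∈ Ioc 0 t₀) ∧ ∑ i, w i = 1 ∧
      ∀ M : Matrix (Fin n) (Fin n) ℝ, (1 + M).det = ∑ i, w i * (1 + v i • M).det := by
  -- `det (1 + t • M)` has degree at most `n` in `t`, so `n + 1` distinct nodes in `(0, t₀]`
  -- determine its value at `t = 1`. The weights are the Lagrange basis polynomials at 1, hence
  -- independent of `M`.
  set v : Fin (n + 1) → ℝ := fun i => t₀ / (i + 1) with hv
  have hinj : Set.InjOn v ((Finset.univ : Finset (Fin (n + 1))) : Set (Fin (n + 1))) := by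
    intro i _ j _ hij
    simp only [hv] at hij
    have hi : (0 : ℝ) < i + 1 := by positivity
    have hj : (0 : ℝ) < j + 1 := by positivity
    rw [div_eq_div_iff hi.ne' hj.ne', mul_right_inj' ht₀.ne'] at hij
    exact Fin.ext (by exact_mod_cast (add_right_cancel hij).symm)
  refine ⟨v, fun i => (Lagrange.basis Finset.univ v i).eval 1, fun i => ⟨by positivity, ?_⟩,
    ?_, fun M => ?_⟩
  · exact div_le_self ht₀.le (by simp)
  · rw [← eval_finsetSum, Lagrange.sum_basis hinj Finset.univ_nonempty, eval_one]
  · set q : ℝ[X] := ((X : ℝ[X]) • M.map C + (1 : Matrix (Fin n) (Fin n) ℝ).map C).det with hq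
    have heval : ∀ t, q.eval t = (1 + t • M).det := by
      intro t
      rw [hq, ← coe_evalRingHom, RingHom.map_det]
      congr 1
      ext i j
      rcases eq_or_ne i j with rfl | hij
      · simp
        ring
      · simp [hij]
        ring
    have hdeg : q.degree < (Finset.univ : Finset (Fin (n + 1))).card := by
      refine lt_of_le_of_lt degree_le_natDegree ?_
      have := natDegree_det_X_add_C_le M (1 : Matrix (Fin n) (Fin n) ℝ)
      rw [Fintype.card_fin] at this
      rw [Finset.card_univ, Fintype.card_fin]
      exact_mod_cast Nat.lt_succ_of_le this
    have h1 := heval 1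
    rw [Lagrange.eq_interpolate hinj hdeg, Lagrange.interpolate_apply, eval_finsetSum,
      one_smul] at h1
    rw [← h1]
    refine Finset.sum_congr rfl fun i _ => ?_
    rw [eval_mul, eval_C, heval, mul_comm]

section InnerProduct

variable [InnerProductSpace ℝ E] [FiniteDimensional ℝ E]

theorem exists_continuousLinearMap_det_one_add_eq_sum {t₀ : ℝ} (ht₀ : 0 < t₀) :
    ∃ v w : Fin (Module.finrank ℝ E + 1) → ℝ, (∀ i, v i ∈ Ioc 0 t₀) ∧ ∑ i, w i = 1 ∧
      ∀ M : E →L[ℝ] E, (1 + M).det = ∑ i, w i * (1 + v i • M).det := by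
  obtain ⟨v, w, hv, hw, h⟩ := exists_det_one_add_eq_sum (Module.finrank ℝ E) ht₀
  refine ⟨v, w, hv, hw, fun M => ?_⟩
  let b := Module.finBasis ℝ E
  have key : ∀ t : ℝ, (1 + t • M).det = (1 + t • LinearMap.toMatrix b b (M : E →ₗ[ℝ] E)).det := by
    intro t
    rw [ContinuousLinearMap.det, ← LinearMap.det_toMatrix b]
    congr 1
    simp [map_add, LinearMap.toMatrix_one]
  have := h (LinearMap.toMatrix b b (M : E →ₗ[ℝ] E))
  rw [← one_smul ℝ M, key, one_smul, this]
  exact Finset.sum_congr rfl fun i _ => by rw [one_smul, key]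

/-- The determinant is 1 at `s = 0` and cannot vanish on the segment `1 + s • M`, which consists of
invertible maps by the Neumann series. -/
theorem det_one_add_pos {M : E →L[ℝ] E} (hM : ‖M‖ < 1) : 0 < (1 + M).det := by
  have hne : ∀ s ∈ Icc (0 : ℝ) 1, (1 + s • M).det ≠ 0 := by
    intro s hs h
    have hs1 : ‖-(s • M)‖ < 1 := by
      rw [norm_neg, norm_smul, Real.norm_of_nonneg hs.1]
      exact lt_of_le_of_lt (mul_le_of_le_one_left (norm_nonneg _) hs.2) hM
    have hu := isUnit_one_sub_of_norm_lt_one hs1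
    rw [sub_neg_eq_add] at hu
    have hu' : IsUnit ((1 + s • M : E →L[ℝ] E) : E →ₗ[ℝ] E) := by
      obtain ⟨u, hu⟩ := hu
      rw [← hu]
      exact u.isUnit.map (ContinuousLinearMap.toLinearMapRingHom (R₁ := ℝ) (M₁ := E))
    exact (LinearMap.isUnit_iff_isUnit_det _).1 hu' |>.ne_zero h
  by_contra hneg
  have hcont : ContinuousOn (fun s : ℝ => (1 + s • M).det) (Icc 0 1) := by
    exact (ContinuousLinearMap.continuous_det.comp (by fun_prop)).continuousOn
  obtain ⟨s, hs, h0⟩ := intermediate_value_Icc' (zero_le_one' ℝ) hcont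
    (show (0 : ℝ) ∈ Icc _ _ from ⟨by simpa using hneg, by simp [ContinuousLinearMap.det]⟩)
  exact hne s hs h0

/-- For small `t` the map `x + t • φ x`, continued by the identity outside the ball, is a bijection
of the space and so permutes the ball. The change of variables formula then makes the integral of
its Jacobian the volume. -/
theorem setIntegral_ball_det_one_add_smul_fderiv [MeasurableSpace E] [BorelSpace E]
    (μ : Measure E) [μ.IsAddHaarMeasure] {φ : E → E} (hφ : ContDiff ℝ 1 φ) {K : ℝ≥0}
    (hK : LipschitzOnWith K φ (closedBall 0 1)) (h0 : ∀ x, ‖x‖ = 1 → φ x = 0)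
    {t : ℝ} (ht : 0 ≤ t) (htK : t * K < 1) :
    ∫ x in ball 0 1, (1 + t • fderiv ℝ φ x).det ∂μ = μ.real (ball 0 1) := by
  have hdet : Continuous fun x => (1 + t • fderiv ℝ φ x).det :=
    ContinuousLinearMap.continuous_det.comp
      (continuous_const.add ((hφ.continuous_fderiv one_ne_zero).const_smul t))
  have hpos : ∀ x ∈ ball (0 : E) 1, 0 < (1 + t • fderiv ℝ φ x).det := by
    intro x hx
    apply det_one_add_pos
    rw [norm_smul, Real.norm_of_nonneg ht]
    refine lt_of_le_of_lt (mul_le_mul_of_nonneg_left ?_ ht) htK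
    exact norm_fderiv_le_of_lipschitzOn ℝ (closedBall_mem_nhds_of_mem hx) hK
  set ψ : E → E := (closedBall (0 : E) 1).indicator φ with hψ
  have hlip : LipschitzWith (t.toNNReal * K) (fun x => t • ψ x) := by
    refine LipschitzWith.of_dist_le_mul fun x y => ?_
    have := (lipschitzWith_indicator_closedBall hK h0).dist_le_mul x y
    rw [dist_smul₀, Real.norm_of_nonneg ht, NNReal.coe_mul, Real.coe_toNNReal t ht, mul_assoc]
    exact mul_le_mul_of_nonneg_left this ht
  have hbij := bijective_id_add_of_lipschitzWith hlip (by
    rwa [← NNReal.coe_lt_coe, NNReal.coe_mul, Real.coe_toNNReal t ht, NNReal.coe_one])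
  have hout : ∀ x ∉ ball (0 : E) 1, x + t • ψ x = x := by
    intro x hx
    have : ψ x = 0 := by
      by_cases hx' : x ∈ closedBall (0 : E) 1
      · rw [hψ, indicator_of_mem hx']
        exact h0 x (le_antisymm (by simpa using hx') (by simpa using hx))
      · rw [hψ, indicator_of_notMem hx']
    simp [this]
  have heq : EqOn (fun x => x + t • φ x) (fun x => x + t • ψ x) (ball 0 1) := by
    intro x hx
    simp only [hψ, indicator_of_mem (ball_subset_closedBall hx)]
  have himage : (fun x => x + t • φ x) '' ball 0 1 = ball 0 1 := by
    rw [heq.image_eq]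
    apply Subset.antisymm
    · rintro _ ⟨x, hx, rfl⟩
      by_contra hy
      have := hbij.1 (hout _ hy)
      exact hy (this.symm ▸ hx)
    · intro y hy
      obtain ⟨x, hx⟩ := hbij.2 y
      refine ⟨x, ?_, hx⟩
      by_contra hx'
      exact hx' ((hout x hx').symm.trans hx ▸ hy)
  have hderiv : ∀ x ∈ ball (0 : E) 1, HasFDerivWithinAt (fun x => x + t • φ x)
      (1 + t • fderiv ℝ φ x) (ball 0 1) x := fun x _ =>
    ((hasFDerivAt_id x).add
      (((hφ.differentiable one_ne_zero) x).hasFDerivAt.const_smul t)).hasFDerivWithinAt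
  have hvol := lintegral_abs_det_fderiv_eq_addHaar_image μ measurableSet_ball hderiv
    (heq.injOn_iff.2 hbij.1.injOn)
  rw [himage] at hvol
  rw [integral_eq_lintegral_of_nonneg_ae _ hdet.aestronglyMeasurable, Measure.real, ← hvol]
  · congr 1
    exact setLIntegral_congr_fun measurableSet_ball fun x hx => by
      simp only [abs_of_pos (hpos x hx)]
  · exact (ae_restrict_mem measurableSet_ball).mono fun x hx => (hpos x hx).le

/-- There is no `C¹` retraction of the unit ball onto the unit sphere. -/
theorem not_contDiff_retraction_sphere {r : E → E} (hr : ContDiff ℝ 1 r) (h1 : ∀ x, ‖r x‖ = 1)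
    (hS : ∀ x, ‖x‖ = 1 → r x = x) : False := by
  let _ : MeasurableSpace E := borel E
  have _ : BorelSpace E := ⟨rfl⟩
  let μ : Measure E := Measure.addHaar
  set φ : E → E := fun x => r x - x with hφdef
  have hφ : ContDiff ℝ 1 φ := hr.sub contDiff_id
  have h0 : ∀ x, ‖x‖ = 1 → φ x = 0 := fun x hx => by simp [hφdef, hS x hx]
  obtain ⟨K, hK⟩ := hφ.contDiffOn.exists_lipschitzOnWith one_ne_zero
    (convex_closedBall (0 : E) 1) (isCompact_closedBall (0 : E) 1)
  -- Every `t ≤ 1 / (K + 1)` satisfies `t * K < 1`. Interpolating from such nodes to `t = 1` gives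
  -- the volume of the ball as the integral of the Jacobian of `r`, but that Jacobian is identically
  -- zero.
  have ht₀ : (0 : ℝ) < 1 / (K + 1) := by positivity
  obtain ⟨v, w, hv, hw, hvw⟩ := exists_continuousLinearMap_det_one_add_eq_sum (E := E) ht₀
  have hintegrable : ∀ i, IntegrableOn (fun x => w i * (1 + v i • fderiv ℝ φ x).det) (ball 0 1) μ := by
    intro i
    have hcont : Continuous fun x => w i * (1 + v i • fderiv ℝ φ x).det :=
      continuous_const.mul (ContinuousLinearMap.continuous_det.comp
        (continuous_const.add ((hφ.continuous_fderiv one_ne_zero).const_smul (v i))))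
    exact (hcont.continuousOn.integrableOn_compact (isCompact_closedBall (0 : E) 1)).mono_set
      ball_subset_closedBall
  have hleft : ∫ x in ball 0 1, (1 + fderiv ℝ φ x).det ∂μ = 0 := by
    have hzero : ∀ x, (1 + fderiv ℝ φ x).det = 0 := by
      intro x
      have hrx : HasFDerivAt r (1 + fderiv ℝ φ x) x := by
        have := (hasFDerivAt_id x).add ((hφ.differentiable one_ne_zero) x).hasFDerivAt
        convert! this using 1
        ext y
        simp [hφdef]
      by_contra hdet
      have hu := (LinearMap.isUnit_iff_isUnit_det _).2 (isUnit_iff_ne_zero.2 hdet)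
      -- If the derivative were onto, some `z` would go to `r x`; differentiating `⟪r, r⟫ = 1` along
      -- `z` would then give `2 * ‖r x‖ ^ 2 = 0`.
      obtain ⟨z, hz⟩ := (Module.End.isUnit_iff _).1 hu |>.2 (r x)
      have hconst : HasFDerivAt (fun y => inner ℝ (r y) (r y)) (0 : E →L[ℝ] ℝ) x := by
        have : (fun y => inner ℝ (r y) (r y)) = fun _ => (1 : ℝ) := by
          ext y
          rw [real_inner_self_eq_norm_sq, h1, one_pow]
        rw [this]
        exact hasFDerivAt_const _ _
      have heq := congrArg (fun L : E →L[ℝ] ℝ => L z) ((hrx.inner ℝ hrx).unique hconst)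
      have hz' : (1 + fderiv ℝ φ x) z = r x := hz
      simp [fderivInnerCLM_apply, hz', h1] at heq
    simp [hzero]
  have hright : ∫ x in ball 0 1, (1 + fderiv ℝ φ x).det ∂μ = μ.real (ball 0 1) := by
    rw [integral_congr_ae (Filter.Eventually.of_forall fun x => hvw (fderiv ℝ φ x)),
      integral_finsetSum _ fun i _ => hintegrable i]
    simp_rw [integral_const_mul]
    refine Eq.trans (Finset.sum_congr rfl fun i _ => ?_)
      ((Finset.sum_mul _ w _).symm.trans (by rw [hw, one_mul]))
    rw [setIntegral_ball_det_one_add_smul_fderiv μ hφ hK h0 (hv i).1.le]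
    refine lt_of_le_of_lt (mul_le_mul_of_nonneg_right (hv i).2 K.2) ?_
    rw [div_mul_eq_mul_div, one_mul, div_lt_one (by positivity)]
    simp
  have hpos : 0 < μ.real (ball (0 : E) 1) :=
    ENNReal.toReal_pos (measure_ball_pos μ _ one_pos).ne' measure_ball_lt_top.ne
  linarith

/-- A continuous vector field uniformly close to the identity has a zero. -/
theorem exists_eq_zero_of_dist_lt {g : E → E} (hg : Continuous g)
    (hd : ∀ x, dist (g x) x < 1 / 4) : ∃ x, g x = 0 := by
  by_contra! hne
  -- The bound `‖g x‖` keeps the approximation free of zeros; the bound `1 / 4` keeps it within `1 /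
  -- 2` of the identity.
  obtain ⟨g₁, hg₁, hd₁, -⟩ := hg.exists_contDiff_approx (ε := fun x => min ‖g x‖ (1 / 4)) 1
    (by fun_prop) (fun x => lt_min (norm_pos_iff.2 (hne x)) (by norm_num))
  have hne₁ : ∀ x, g₁ x ≠ 0 := by
    intro x hx
    have := (hd₁ x).trans_le (min_le_left _ _)
    rw [hx, dist_zero_left] at this
    exact this.false
  have hclose : ∀ x, ‖g₁ x - x‖ < 1 / 2 := by
    intro x
    have h1 := (hd₁ x).trans_le (min_le_right _ _)
    have h2 := dist_triangle (g₁ x) (g x) x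
    rw [← dist_eq_norm]
    linarith [hd x]
  let χ : ContDiffBump (0 : E) := ⟨1 / 2, 1, by norm_num, by norm_num⟩
  -- `g₂` is `g₁` on the ball of radius `1 / 2` and the identity on the unit sphere. In between `‖x‖
  -- > 1 / 2` exceeds the displacement, so there is no zero and normalizing gives a retraction.
  set g₂ : E → E := fun x => x + χ x • (g₁ x - x) with hg₂def
  have hg₂ : ContDiff ℝ 1 g₂ := contDiff_id.add (χ.contDiff.smul (hg₁.sub contDiff_id))
  have hne₂ : ∀ x, g₂ x ≠ 0 := by
    intro x hx
    by_cases hx2 : ‖x‖ ≤ 1 / 2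
    · have : χ x = 1 := χ.one_of_mem_closedBall (by simpa [χ] using hx2)
      apply hne₁ x
      simpa [hg₂def, this] using hx
    · have h3 : x = -(χ x • (g₁ x - x)) := eq_neg_of_add_eq_zero_left hx
      have h4 : ‖x‖ = ‖χ x • (g₁ x - x)‖ := by
        conv_lhs => rw [h3, norm_neg]
      rw [norm_smul, Real.norm_of_nonneg χ.nonneg] at h4
      have := mul_le_of_le_one_left (norm_nonneg (g₁ x - x)) (χ.le_one (x := x))
      linarith [hclose x]
  refine not_contDiff_retraction_sphere (r := fun x => ‖g₂ x‖⁻¹ • g₂ x)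
    (((hg₂.norm ℝ hne₂).inv fun x => norm_ne_zero_iff.2 (hne₂ x)).smul hg₂)
    (fun x => by simp [norm_smul, hne₂ x]) fun x hx => ?_
  have : χ x = 0 := χ.zero_of_le_dist (by simp [χ, hx])
  simp [hg₂def, this, hx]

/-- If `F` had smaller dimension, a `C¹` approximation `G` of the inverse would miss some `c` near
0. Then `G ∘ f - c` would be close to the identity (`1 / 8 + 1 / 8 = 1 / 4`) and yet have no zero.
-/
theorem finrank_le_of_homeomorph [NormedSpace ℝ F] [FiniteDimensional ℝ F] (f : E ≃ₜ F) :
    Module.finrank ℝ E ≤ Module.finrank ℝ F := by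
  by_contra! hlt
  obtain ⟨G, hG, hd, -⟩ := f.symm.continuous.exists_contDiff_approx (ε := fun _ => 1 / 8) 1
    (by fun_prop) (fun _ => by norm_num)
  obtain ⟨c, hc, hcd⟩ := (hG.dense_compl_range_of_finrank_lt_finrank hlt).exists_dist_lt 0
    (show (0 : ℝ) < 1 / 8 by norm_num)
  obtain ⟨x, hx⟩ := exists_eq_zero_of_dist_lt (g := fun x => G (f x) - c)
    ((hG.continuous.comp f.continuous).sub continuous_const) fun x => by
      have h1 := hd (f x)
      rw [f.symm_apply_apply, dist_eq_norm] at h1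
      rw [dist_zero_left] at hcd
      rw [dist_eq_norm, sub_right_comm]
      linarith [norm_sub_le (G (f x) - x) c]
  exact hc ⟨f x, sub_eq_zero.1 hx⟩

end InnerProduct

/-- Invariance of dimension. -/
theorem Homeomorph.finrank_eq [NormedSpace ℝ E] [FiniteDimensional ℝ E] [NormedSpace ℝ F]
    [FiniteDimensional ℝ F] (f : E ≃ₜ F) : Module.finrank ℝ E = Module.finrank ℝ F := by
  have hE : Module.finrank ℝ E = Module.finrank ℝ
      (EuclideanSpace ℝ (Fin (Module.finrank ℝ E))) := by simp
  have hF : Module.finrank ℝ F = Module.finrank ℝ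
      (EuclideanSpace ℝ (Fin (Module.finrank ℝ F))) := by simp
  let e := (ContinuousLinearEquiv.ofFinrankEq hE).toHomeomorph
  let e' := (ContinuousLinearEquiv.ofFinrankEq hF).toHomeomorph
  apply le_antisymm
  · have := finrank_le_of_homeomorph (e.symm.trans f)
    rwa [← hE] at this
  · have := finrank_le_of_homeomorph (e'.symm.trans f.symm)
    rwa [← hF] at this

end Topology

end InvarianceOfDimension

/-! ### Linear flows and their stable subspaces. -/

section Flow

open Set Filter Matrix

open scoped Topology Matrix.Norms.Operator

namespace ObservedODE

section Exponential

variable {𝕜 : Type*} [RCLike 𝕜] {n m : ℕ}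

variable (𝕜 n) in
/-- Multiplication of a vector by a square matrix, as a continuous bilinear map. -/
noncomputable def mulVecCLM :
    Matrix (Fin n) (Fin n) 𝕜 →L[𝕜] (Fin n → 𝕜) →L[𝕜] (Fin n → 𝕜) :=
  LinearMap.toContinuousBilinearMap
    (Matrix.mulVecBilin 𝕜 𝕜 : Matrix (Fin n) (Fin n) 𝕜 →ₗ[𝕜] (Fin n → 𝕜) →ₗ[𝕜] (Fin n → 𝕜))

theorem hasSum_exp_mulVec (A : Matrix (Fin n) (Fin n) 𝕜) (x : Fin n → 𝕜) :
    HasSum (fun k : ℕ => ((k.factorial : 𝕜)⁻¹) • (A ^ k *ᵥ x)) (NormedSpace.exp A *ᵥ x) := by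
  have h := NormedSpace.exp_series_hasSum_exp' (𝕂 := 𝕜) A
  exact (h.mapL ((mulVecCLM 𝕜 n).flip x)).congr_fun fun k => (smul_mulVec _ _ _).symm

/-- The relation passes through powers and the exponential series. It transports flows between the
whole space and its blocks. -/
theorem exp_mulVec_of_intertwine {A : Matrix (Fin n) (Fin n) 𝕜} {B : Matrix (Fin m) (Fin m) 𝕜}
    {J : Matrix (Fin n) (Fin m) 𝕜} (h : A * J = J * B) (t : 𝕜) (y : Fin m → 𝕜) :
    NormedSpace.exp (t • A) *ᵥ (J *ᵥ y) = J *ᵥ (NormedSpace.exp (t • B) *ᵥ y) := by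
  have hpow : ∀ k : ℕ, (t • A) ^ k * J = J * (t • B) ^ k := by
    intro k
    induction k with
    | zero => simp
    | succ k ih =>
      rw [pow_succ, pow_succ, Matrix.mul_assoc, smul_mul, h, ← Matrix.mul_smul, ← Matrix.mul_assoc, ih,
        Matrix.mul_assoc]
  have h1 := hasSum_exp_mulVec (t • A) (J *ᵥ y)
  have h2 := (hasSum_exp_mulVec (t • B) y).mapL (Matrix.mulVecLin J).toContinuousLinearMap
  refine h1.unique ?_
  convert! h2 using 2 with k
  simp [mulVec_mulVec, hpow]

theorem exp_mulVec_eq_sum_of_pow_mulVec_eq_zero {A : Matrix (Fin n) (Fin n) 𝕜} {x : Fin n → 𝕜}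
    {k : ℕ} (h : A ^ k *ᵥ x = 0) (t : 𝕜) :
    NormedSpace.exp (t • A) *ᵥ x =
      ∑ j ∈ Finset.range k, ((j.factorial : 𝕜)⁻¹ * t ^ j) • (A ^ j *ᵥ x) := by
  refine (hasSum_exp_mulVec (t • A) x).unique ?_
  have : ∀ j ∉ Finset.range k, ((j.factorial : 𝕜)⁻¹) • ((t • A) ^ j *ᵥ x) = 0 := by
    intro j hj
    obtain ⟨i, rfl⟩ := Nat.exists_eq_add_of_le' (not_lt.1 (Finset.mem_range.not.1 hj))
    rw [smul_pow, smul_mulVec, pow_add A, ← mulVec_mulVec, h]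
    simp
  rw [show ∑ j ∈ Finset.range k, ((j.factorial : 𝕜)⁻¹ * t ^ j) • (A ^ j *ᵥ x) =
    ∑ j ∈ Finset.range k, ((j.factorial : 𝕜)⁻¹) • ((t • A) ^ j *ᵥ x) from ?_]
  · exact hasSum_sum_of_ne_finset_zero this
  exact Finset.sum_congr rfl fun j _ => by rw [smul_pow, smul_mulVec, smul_smul]

theorem exp_smul_mulVec_eq (B : Matrix (Fin n) (Fin n) 𝕜) (μ t : 𝕜) (x : Fin n → 𝕜) :
    NormedSpace.exp (t • B) *ᵥ x =
      NormedSpace.exp (t * μ) • (NormedSpace.exp (t • (B - algebraMap 𝕜 _ μ)) *ᵥ x) := by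
  have h1 : t • B = algebraMap 𝕜 _ (t * μ) + t • (B - algebraMap 𝕜 _ μ) := by
    rw [smul_sub, map_mul, Algebra.smul_def t (algebraMap 𝕜 _ μ)]
    abel
  have h2 : NormedSpace.exp (algebraMap 𝕜 (Matrix (Fin n) (Fin n) 𝕜) (t * μ)) =
      algebraMap 𝕜 _ (NormedSpace.exp (t * μ)) := (NormedSpace.algebraMap_exp_comm _).symm
  conv_lhs => rw [h1]
  rw [Matrix.exp_add_of_commute _ _ (Algebra.commute_algebraMap_left _ _),
    h2, ← Algebra.smul_def, smul_mulVec]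

end Exponential

section Real

variable {n : ℕ}

/-- The flow of `x' = A x`. -/
noncomputable def flow (A : Matrix (Fin n) (Fin n) ℝ) (t : ℝ) (x : Fin n → ℝ) : Fin n → ℝ :=
  NormedSpace.exp (t • A) *ᵥ x

theorem flow_zero (A : Matrix (Fin n) (Fin n) ℝ) (x : Fin n → ℝ) : flow A 0 x = x := by
  simp [flow]

theorem flow_neg_matrix (A : Matrix (Fin n) (Fin n) ℝ) (t : ℝ) (x : Fin n → ℝ) :
    flow (-A) t x = flow A (-t) x := by
  simp [flow]

theorem flow_flow_neg (A : Matrix (Fin n) (Fin n) ℝ) (t : ℝ) (x : Fin n → ℝ) :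
    flow A t (flow A (-t) x) = x := by
  rw [flow, flow, mulVec_mulVec, ← Matrix.exp_add_of_commute _ _
    ((Commute.refl A).smul_left _ |>.smul_right _), ← add_smul]
  simp

theorem flow_add_vec (A : Matrix (Fin n) (Fin n) ℝ) (t : ℝ) (x y : Fin n → ℝ) :
    flow A t (x + y) = flow A t x + flow A t y := mulVec_add _ _ _

theorem flow_mulVec_comm (A : Matrix (Fin n) (Fin n) ℝ) (t : ℝ) (x : Fin n → ℝ) :
    flow A t (A *ᵥ x) = A *ᵥ flow A t x :=
  exp_mulVec_of_intertwine rfl t x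

theorem hasDerivAt_flow (A : Matrix (Fin n) (Fin n) ℝ) (x : Fin n → ℝ) (t : ℝ) :
    HasDerivAt (fun s => flow A s x) (A *ᵥ flow A t x) t := by
  have h := hasDerivAt_exp_smul_const A t
  have := ((mulVecCLM ℝ n).flip x).hasFDerivAt.comp_hasDerivAt t h
  rw [← flow_mulVec_comm, flow, mulVec_mulVec]
  exact this

/-- The curve `exp (-tA) y(t)` has zero derivative on `[0, ∞)`, hence is constant. -/
theorem eq_flow_of_hasDerivWithinAt {A : Matrix (Fin n) (Fin n) ℝ} {y : ℝ → Fin n → ℝ}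
    (hy : ∀ t ∈ Ici (0 : ℝ), HasDerivWithinAt y (A *ᵥ y t) (Ici 0) t) {t : ℝ} (ht : 0 ≤ t) :
    y t = flow A t (y 0) := by
  have hz : ∀ s ∈ Ici (0 : ℝ), HasDerivWithinAt (fun s => flow (-A) s (y s)) 0 (Ici 0) s := by
    intro s hs
    have h1 := (hasDerivAt_exp_smul_const (-A) s).hasDerivWithinAt (s := Ici 0)
    have h2 := (mulVecCLM ℝ n).hasDerivWithinAt_of_bilinear h1 (hy s hs)
    convert! h2 using 1
    change 0 = _ *ᵥ (A *ᵥ y s) + (_ * -A) *ᵥ y s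
    rw [mulVec_mulVec, ← add_mulVec, Matrix.mul_neg, add_neg_cancel, zero_mulVec]
  have hconst := constant_of_has_deriv_right_zero (f := fun s => flow (-A) s (y s))
    (a := 0) (b := t)
    (fun s hs => (hz s hs.1).continuousWithinAt.mono Icc_subset_Ici_self)
    (fun s hs => (hz s hs.1).mono (Ici_subset_Ici.2 hs.1)) t ⟨ht, le_rfl⟩
  simp only [flow_zero] at hconst
  rw [← hconst, flow_neg_matrix, flow_flow_neg]

theorem isTrajectory_flow {p : ℕ} (A : Matrix (Fin n) (Fin n) ℝ) (C : Matrix (Fin p) (Fin n) ℝ)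
    (x : Fin n → ℝ) :
    IsTrajectory A C (fun t => flow A t x) (fun t => C *ᵥ flow A t x) :=
  ⟨fun t _ => (hasDerivAt_flow A x t).hasDerivWithinAt, fun _ _ => rfl⟩

/-- The stable subspace of `x' = A x`. -/
noncomputable def stableSubspace (A : Matrix (Fin n) (Fin n) ℝ) : Submodule ℝ (Fin n → ℝ) where
  carrier := {x | Tendsto (fun t => flow A t x) atTop (𝓝 0)}
  add_mem' {x y} hx hy := by
    have := hx.add hy
    simp only [add_zero] at this
    exact this.congr fun t => (flow_add_vec A t x y).symm
  zero_mem' := by simp [flow]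
  smul_mem' c x hx := by
    have := hx.const_smul c
    rw [smul_zero] at this
    exact this.congr fun t => (mulVec_smul _ _ _).symm

theorem mem_stableSubspace {A : Matrix (Fin n) (Fin n) ℝ} {x : Fin n → ℝ} :
    x ∈ stableSubspace A ↔ Tendsto (fun t => flow A t x) atTop (𝓝 0) := Iff.rfl

/-- The complexification of the flow of a real matrix. -/
theorem ofReal_flow (A : Matrix (Fin n) (Fin n) ℝ) (t : ℝ) (x : Fin n → ℝ) :
    (fun i => ((flow A t x i : ℝ) : ℂ)) =
      NormedSpace.exp ((t : ℂ) • A.map (algebraMap ℝ ℂ)) *ᵥ (fun i => (x i : ℂ)) := by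
  have h1 : (algebraMap ℝ ℂ).mapMatrix (NormedSpace.exp (t • A)) =
      NormedSpace.exp ((algebraMap ℝ ℂ).mapMatrix (t • A)) :=
    NormedSpace.map_exp _ (Continuous.matrix_map continuous_id Complex.continuous_ofReal) _
  have h2 : (algebraMap ℝ ℂ).mapMatrix (t • A) = (t : ℂ) • A.map (algebraMap ℝ ℂ) := by
    ext i j
    simp
  rw [← h2, ← h1]
  ext i
  simp [flow, mulVec, dotProduct]

end Real

section Complex

variable {n : ℕ}

/-- The stable subspace of a complex linear system. -/
noncomputable def complexStableSubspace (B : Matrix (Fin n) (Fin n) ℂ) :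
    Submodule ℂ (Fin n → ℂ) where
  carrier := {x | Tendsto (fun t : ℝ => NormedSpace.exp ((t : ℂ) • B) *ᵥ x) atTop (𝓝 0)}
  add_mem' {x y} hx hy := by
    have := hx.add hy
    simp only [add_zero] at this
    exact this.congr fun t => (mulVec_add _ _ _).symm
  zero_mem' := by simp
  smul_mem' c x hx := by
    have := hx.const_smul c
    rw [smul_zero] at this
    exact this.congr fun t => (mulVec_smul _ _ _).symm

theorem mem_complexStableSubspace {B : Matrix (Fin n) (Fin n) ℂ} {x : Fin n → ℂ} :
    x ∈ complexStableSubspace B ↔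
      Tendsto (fun t : ℝ => NormedSpace.exp ((t : ℂ) • B) *ᵥ x) atTop (𝓝 0) := Iff.rfl

theorem mem_stableSubspace_iff_complex {A : Matrix (Fin n) (Fin n) ℝ} {x : Fin n → ℝ} :
    x ∈ stableSubspace A ↔
      (fun i => (x i : ℂ)) ∈ complexStableSubspace (A.map (algebraMap ℝ ℂ)) := by
  rw [mem_stableSubspace, mem_complexStableSubspace]
  simp_rw [← ofReal_flow, tendsto_pi_nhds, Pi.zero_apply]
  refine forall_congr' fun i => ⟨fun h => ?_, fun h => ?_⟩
  · exact (Complex.continuous_ofReal.tendsto 0).comp h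
  · exact (Complex.continuous_re.tendsto 0).comp h

theorem hasEigenvalue_iff_mem_spectrum {B : Matrix (Fin n) (Fin n) ℂ} {μ : ℂ} :
    Module.End.HasEigenvalue (Matrix.toLin' B) μ ↔ μ ∈ spectrum ℂ B := by
  rw [Module.End.hasEigenvalue_iff_mem_spectrum, Matrix.spectrum_toLin']

theorem toLin'_sub_pow_apply (B : Matrix (Fin n) (Fin n) ℂ) (μ : ℂ) (k : ℕ) (x : Fin n → ℂ) :
    ((Matrix.toLin' B - algebraMap ℂ _ μ) ^ k) x = (B - algebraMap ℂ _ μ) ^ k *ᵥ x := by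
  rw [← Matrix.toLin'_apply, Matrix.toLin'_pow, map_sub]
  congr 3
  ext i j
  simp [Matrix.algebraMap_eq_diagonal, Pi.single_apply]

theorem tendsto_exp_mul_pow {μ : ℂ} (hμ : μ.re < 0) (j : ℕ) :
    Tendsto (fun t : ℝ => NormedSpace.exp ((t : ℂ) * μ) * (t : ℂ) ^ j) atTop (𝓝 0) := by
  rw [tendsto_zero_iff_norm_tendsto_zero]
  have h := tendsto_rpow_mul_exp_neg_mul_atTop_nhds_zero j (-μ.re) (neg_pos.2 hμ)
  refine h.congr' ?_
  filter_upwards [eventually_ge_atTop 0] with t ht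
  rw [← Complex.exp_eq_exp_ℂ, norm_mul, Complex.norm_exp, norm_pow, Complex.norm_real,
    Real.norm_of_nonneg ht, Real.rpow_natCast, mul_comm]
  congr 2
  simp [mul_comm]

/-- Generalized eigenvectors span, and on each of them the flow is `exp (t * μ)` times a polynomial
in `t`. -/
theorem complexStableSubspace_eq_top {B : Matrix (Fin n) (Fin n) ℂ}
    (hB : ∀ μ ∈ spectrum ℂ B, μ.re < 0) : complexStableSubspace B = ⊤ := by
  rw [eq_top_iff, ← Module.End.iSup_maxGenEigenspace_eq_top (Matrix.toLin' B), iSup_le_iff]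
  intro μ x hx
  obtain ⟨k, hk⟩ := (Module.End.mem_maxGenEigenspace _ _ _).1 hx
  rcases eq_or_ne x 0 with rfl | hx0
  · exact Submodule.zero_mem _
  have hμ : μ ∈ spectrum ℂ B := by
    rw [← hasEigenvalue_iff_mem_spectrum]
    refine Module.End.hasEigenvalue_of_hasGenEigenvalue (f := Matrix.toLin' B) (k := k) ?_
    intro hbot
    apply hx0
    rw [← Submodule.mem_bot ℂ, ← hbot, Module.End.mem_genEigenspace_nat]
    exact hk
  have hk' : (B - algebraMap ℂ _ μ) ^ k *ᵥ x = 0 := by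
    rw [← toLin'_sub_pow_apply, Module.algebraMap_end_eq_smul_id]
    exact hk
  rw [mem_complexStableSubspace]
  simp_rw [exp_smul_mulVec_eq B μ, exp_mulVec_eq_sum_of_pow_mulVec_eq_zero hk', Finset.smul_sum,
    smul_smul]
  rw [← Finset.sum_const_zero (s := Finset.range k)]
  refine tendsto_finsetSum _ fun j _ => ?_
  rw [← zero_smul ℂ ((B - algebraMap ℂ _ μ) ^ j *ᵥ x)]
  refine Tendsto.smul_const ?_ _
  have := (tendsto_exp_mul_pow (hB μ hμ) j).const_mul ((j.factorial : ℂ)⁻¹)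
  rw [mul_zero] at this
  exact this.congr fun t => by ring

/-- The stable subspace is invariant, so if nonzero it contains an eigenvector `v`. But `‖exp (t *
μ) • v‖ ≥ ‖v‖` for `t ≥ 0`, so no analysis of Jordan blocks is needed. -/
theorem complexStableSubspace_eq_bot {B : Matrix (Fin n) (Fin n) ℂ}
    (hB : ∀ μ ∈ spectrum ℂ B, 0 ≤ μ.re) : complexStableSubspace B = ⊥ := by
  by_contra hne
  have hinv : ∀ x ∈ complexStableSubspace B, Matrix.toLin' B x ∈ complexStableSubspace B := by
    intro x hx
    rw [mem_complexStableSubspace] at hx ⊢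
    have := ((Matrix.mulVecLin B).toContinuousLinearMap.continuous.tendsto 0).comp hx
    rw [map_zero] at this
    exact this.congr fun t => (exp_mulVec_of_intertwine rfl _ x).symm
  have : Nontrivial (complexStableSubspace B) := Submodule.nontrivial_iff_ne_bot.2 hne
  obtain ⟨μ, hμ⟩ := Module.End.exists_eigenvalue ((Matrix.toLin' B).restrict hinv)
  obtain ⟨v, hv⟩ := hμ.exists_hasEigenvector
  have hv0 : (v : Fin n → ℂ) ≠ 0 := fun h => hv.2 (Subtype.ext h)
  have hBv : Matrix.toLin' B v = μ • (v : Fin n → ℂ) := congrArg Subtype.val hv.apply_eq_smul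
  have hμB : μ ∈ spectrum ℂ B := by
    rw [← hasEigenvalue_iff_mem_spectrum]
    exact Module.End.hasEigenvalue_of_hasEigenvector
      (Module.End.hasEigenvector_iff.2 ⟨Module.End.mem_eigenspace_iff.2 hBv, hv0⟩)
  have hk : (B - algebraMap ℂ _ μ) ^ 1 *ᵥ (v : Fin n → ℂ) = 0 := by
    rw [← toLin'_sub_pow_apply]
    simp [hBv]
  have htend := mem_complexStableSubspace.1 v.2
  simp_rw [exp_smul_mulVec_eq B μ, exp_mulVec_eq_sum_of_pow_mulVec_eq_zero hk] at htend
  simp only [Finset.range_one, Finset.sum_singleton, Nat.factorial_zero, Nat.cast_one, inv_one,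
    pow_zero, mul_one, one_smul, one_mulVec] at htend
  have hle : ∀ᶠ t : ℝ in atTop,
      ‖(v : Fin n → ℂ)‖ ≤ ‖NormedSpace.exp ((t : ℂ) * μ) • (v : Fin n → ℂ)‖ := by
    filter_upwards [eventually_ge_atTop 0] with t ht
    rw [norm_smul, ← Complex.exp_eq_exp_ℂ, Complex.norm_exp]
    refine le_mul_of_one_le_left (norm_nonneg _) (Real.one_le_exp ?_)
    simpa using mul_nonneg ht (hB μ hμB)
  have := ge_of_tendsto htend.norm hle
  rw [norm_zero] at this
  exact hv0 (norm_le_zero_iff.1 this)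

end Complex

section Spectral

variable {n : ℕ}

theorem stableSubspace_eq_top {A : Matrix (Fin n) (Fin n) ℝ} (hA : ∀ μ ∈ eigenvalues A, μ.re < 0) :
    stableSubspace A = ⊤ := by
  refine eq_top_iff.2 fun x _ => mem_stableSubspace_iff_complex.2 ?_
  rw [complexStableSubspace_eq_top hA]
  trivial

theorem stableSubspace_eq_bot {A : Matrix (Fin n) (Fin n) ℝ} (hA : ∀ μ ∈ eigenvalues A, 0 ≤ μ.re) :
    stableSubspace A = ⊥ := by
  refine eq_bot_iff.2 fun x hx => ?_
  rw [mem_stableSubspace_iff_complex, complexStableSubspace_eq_bot hA, Submodule.mem_bot] at hx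
  rw [Submodule.mem_bot]
  ext i
  simpa using congrFun hx i

theorem mem_eigenvalues_neg {A : Matrix (Fin n) (Fin n) ℝ} {μ : ℂ} :
    μ ∈ eigenvalues (-A) ↔ -μ ∈ eigenvalues A := by
  have : (-A).map (algebraMap ℝ ℂ) = -A.map (algebraMap ℝ ℂ) := by
    ext i j
    simp
  rw [eigenvalues, eigenvalues, this, ← spectrum.neg_eq, Set.mem_neg]

variable {a b c : ℕ}

/-- The stable subspace of a system that splits into a stable and two non-stable blocks. -/
theorem stableSubspace_eq_range {A : Matrix (Fin n) (Fin n) ℝ}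
    {B : Matrix (Fin a) (Fin a) ℝ} {B₁ : Matrix (Fin b) (Fin b) ℝ} {B₂ : Matrix (Fin c) (Fin c) ℝ}
    {J : Matrix (Fin n) (Fin a) ℝ} {J₁ : Matrix (Fin n) (Fin b) ℝ} {J₂ : Matrix (Fin n) (Fin c) ℝ}
    {K : Matrix (Fin a) (Fin n) ℝ} {K₁ : Matrix (Fin b) (Fin n) ℝ} {K₂ : Matrix (Fin c) (Fin n) ℝ}
    (hsum : J * K + J₁ * K₁ + J₂ * K₂ = 1) (hJ : A * J = J * B)
    (hK₁ : K₁ * A = B₁ * K₁) (hK₂ : K₂ * A = B₂ * K₂)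
    (hB : ∀ μ ∈ eigenvalues B, μ.re < 0) (hB₁ : ∀ μ ∈ eigenvalues B₁, 0 ≤ μ.re)
    (hB₂ : ∀ μ ∈ eigenvalues B₂, 0 ≤ μ.re) :
    stableSubspace A = LinearMap.range (Matrix.mulVecLin J) := by
  have push : ∀ {k l : ℕ} {X : Matrix (Fin k) (Fin k) ℝ} {Y : Matrix (Fin l) (Fin l) ℝ}
      {M : Matrix (Fin k) (Fin l) ℝ}, X * M = M * Y → ∀ {y}, y ∈ stableSubspace Y →
      M *ᵥ y ∈ stableSubspace X := by
    intro k l X Y M h y hy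
    have := ((Matrix.mulVecLin M).toContinuousLinearMap.continuous.tendsto 0).comp
      (mem_stableSubspace.1 hy)
    rw [map_zero] at this
    exact this.congr fun t => (exp_mulVec_of_intertwine h t y).symm
  apply le_antisymm
  · intro x hx
    have h1 := push hK₁.symm hx
    have h2 := push hK₂.symm hx
    rw [stableSubspace_eq_bot hB₁, Submodule.mem_bot] at h1
    rw [stableSubspace_eq_bot hB₂, Submodule.mem_bot] at h2
    -- The two non-stable components of `x` are stable vectors of their blocks, hence zero, which
    -- leaves `x = J *ᵥ (K *ᵥ x)`.
    refine ⟨K *ᵥ x, ?_⟩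
    have := congrArg (· *ᵥ x) hsum
    simp only [add_mulVec, ← mulVec_mulVec, h1, h2, one_mulVec, mulVec_zero, add_zero] at this
    exact this
  · rintro _ ⟨y, rfl⟩
    exact push hJ (by rw [stableSubspace_eq_top hB]; trivial)

end Spectral

end ObservedODE

end Flow

/-! ### Unobservable subspaces and their splitting along spectral blocks. -/

section Observability

open Set Filter Matrix Polynomial

namespace ObservedODE

section Unobservable

variable {n p m : ℕ}

/-- The unobservable subspace of `(A, C)`. -/
def unobservable (A : Matrix (Fin n) (Fin n) ℝ) (C : Matrix (Fin p) (Fin n) ℝ) :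
    Submodule ℝ (Fin n → ℝ) where
  carrier := {x | ∀ i : ℕ, C *ᵥ (A ^ i *ᵥ x) = 0}
  add_mem' {x y} hx hy i := by rw [mulVec_add, mulVec_add, hx i, hy i, add_zero]
  zero_mem' i := by simp
  smul_mem' c x hx i := by rw [mulVec_smul, mulVec_smul, hx i, smul_zero]

theorem mem_unobservable {A : Matrix (Fin n) (Fin n) ℝ} {C : Matrix (Fin p) (Fin n) ℝ}
    {x : Fin n → ℝ} : x ∈ unobservable A C ↔ ∀ i : ℕ, C *ᵥ (A ^ i *ᵥ x) = 0 := Iff.rfl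

theorem mulVec_mem_unobservable {A : Matrix (Fin n) (Fin n) ℝ} {C : Matrix (Fin p) (Fin n) ℝ}
    {x : Fin n → ℝ} (hx : x ∈ unobservable A C) : A *ᵥ x ∈ unobservable A C := by
  intro i
  rw [mulVec_mulVec x, ← pow_succ]
  exact hx (i + 1)

theorem aeval_mulVec_mem_unobservable {A : Matrix (Fin n) (Fin n) ℝ}
    {C : Matrix (Fin p) (Fin n) ℝ} {x : Fin n → ℝ} (hx : x ∈ unobservable A C) (q : ℝ[X]) :
    aeval A q *ᵥ x ∈ unobservable A C := by
  induction q using Polynomial.induction_on' with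
  | add q r hq hr =>
    rw [map_add, add_mulVec]
    exact Submodule.add_mem _ hq hr
  | monomial k a =>
    rw [aeval_monomial, ← Algebra.smul_def, smul_mulVec]
    refine Submodule.smul_mem _ _ ?_
    induction k with
    | zero => simpa using hx
    | succ k ih =>
      rw [pow_succ', ← mulVec_mulVec]
      exact mulVec_mem_unobservable ih

/-- One direction is the exponential series; the other differentiates the zero observation
repeatedly at `t = 0`. This form is the one a homeomorphism can transport. -/
theorem mem_unobservable_iff_flow {A : Matrix (Fin n) (Fin n) ℝ} {C : Matrix (Fin p) (Fin n) ℝ}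
    {x : Fin n → ℝ} : x ∈ unobservable A C ↔ ∀ t, C *ᵥ flow A t x = 0 := by
  constructor
  · intro hx t
    have h := (hasSum_exp_mulVec (t • A) x).mapL (Matrix.mulVecLin C).toContinuousLinearMap
    refine h.unique ?_
    convert! hasSum_zero using 2 with k
    change C *ᵥ _ = 0
    rw [_root_.smul_pow, smul_mulVec, mulVec_smul, mulVec_smul, hx k, smul_zero, smul_zero]
  · intro hx i
    have hpow : ∀ t, C *ᵥ flow A t (A ^ i *ᵥ x) = 0 := by
      induction i with
      | zero => simpa using hx
      | succ i ih =>
        intro t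
        have h := (Matrix.mulVecLin C).toContinuousLinearMap.hasFDerivAt.comp_hasDerivAt t
          (hasDerivAt_flow A (A ^ i *ᵥ x) t)
        have h0 : HasDerivAt (fun t => C *ᵥ flow A t (A ^ i *ᵥ x)) 0 t := by
          simp_rw [ih]
          exact hasDerivAt_const _ _
        rw [pow_succ', ← mulVec_mulVec, flow_mulVec_comm]
        exact h.unique h0
    simpa [flow_zero] using hpow 0

/-- By Cayley–Hamilton every power of `A` is a combination of the powers below `n`. -/
theorem ker_obsMatrix (A : Matrix (Fin n) (Fin n) ℝ) (C : Matrix (Fin p) (Fin n) ℝ) :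
    LinearMap.ker (obsMatrix A C).mulVecLin = unobservable A C := by
  have hentry : ∀ x i, (obsMatrix A C *ᵥ x) i = (C *ᵥ (A ^ (i.1 : ℕ) *ᵥ x)) i.2 := by
    intro x i
    rw [mulVec_mulVec]
    rfl
  ext x
  rw [LinearMap.mem_ker, mulVecLin_apply]
  constructor
  · intro hx i
    -- For `n = 0` the remainder has `natDegree` 0, which is not below `n`.
    rcases Nat.eq_zero_or_pos n with rfl | hn
    · rw [Subsingleton.elim x 0]
      simp
    have hlow : ∀ j < n, C *ᵥ (A ^ j *ᵥ x) = 0 := by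
      intro j hj
      ext l
      rw [← hentry x (⟨j, hj⟩, l), hx]
      rfl
    have hdeg : (X ^ i %ₘ A.charpoly).natDegree < n := by
      have := natDegree_modByMonic_lt (X ^ i) A.charpoly_monic (fun h => by
        have hd := A.charpoly_natDegree_eq_dim
        rw [h, natDegree_one, Fintype.card_fin] at hd
        omega)
      rwa [A.charpoly_natDegree_eq_dim, Fintype.card_fin] at this
    rw [A.pow_eq_aeval_mod_charpoly, aeval_eq_sum_range' hdeg, Matrix.sum_mulVec, mulVec_sum]
    refine Finset.sum_eq_zero fun j hj => ?_
    rw [smul_mulVec, mulVec_smul, hlow j (Finset.mem_range.1 hj), smul_zero]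
  · intro hx
    ext i
    rw [hentry, hx]
    rfl

theorem kObs_add_finrank_unobservable (A : Matrix (Fin n) (Fin n) ℝ)
    (C : Matrix (Fin p) (Fin n) ℝ) :
    kObs A C + Module.finrank ℝ (unobservable A C) = n := by
  rw [← ker_obsMatrix]
  have := LinearMap.finrank_range_add_finrank_ker (obsMatrix A C).mulVecLin
  rwa [Module.finrank_fin_fun] at this

theorem comap_unobservable {A : Matrix (Fin n) (Fin n) ℝ} {B : Matrix (Fin m) (Fin m) ℝ}
    {J : Matrix (Fin n) (Fin m) ℝ} (h : A * J = J * B) (C : Matrix (Fin p) (Fin n) ℝ) :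
    (unobservable A C).comap J.mulVecLin = unobservable B (C * J) := by
  have hpow : ∀ k : ℕ, A ^ k * J = J * B ^ k := by
    intro k
    induction k with
    | zero => simp
    | succ k ih =>
      rw [pow_succ, pow_succ, Matrix.mul_assoc, h, ← Matrix.mul_assoc, ih, Matrix.mul_assoc]
  ext y
  rw [Submodule.mem_comap, mem_unobservable, mem_unobservable, mulVecLin_apply]
  refine forall_congr' fun i => ?_
  rw [mulVec_mulVec y, hpow, mulVec_mulVec, mulVec_mulVec, Matrix.mul_assoc]

theorem injective_mulVecLin_of_mul_eq_one {J : Matrix (Fin n) (Fin m) ℝ}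
    {K : Matrix (Fin m) (Fin n) ℝ} (h : K * J = 1) : Function.Injective J.mulVecLin := by
  intro x y hxy
  have := congrArg (K *ᵥ ·) hxy
  simpa [mulVec_mulVec, h] using this

theorem finrank_unobservable_inf_range {A : Matrix (Fin n) (Fin n) ℝ}
    {B : Matrix (Fin m) (Fin m) ℝ} {J : Matrix (Fin n) (Fin m) ℝ} {K : Matrix (Fin m) (Fin n) ℝ}
    (hKJ : K * J = 1) (h : A * J = J * B) (C : Matrix (Fin p) (Fin n) ℝ) :
    Module.finrank ℝ ↥(unobservable A C ⊓ LinearMap.range J.mulVecLin) =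
      Module.finrank ℝ (unobservable B (C * J)) := by
  rw [inf_comm, ← Submodule.map_comap_eq, comap_unobservable h]
  exact (Submodule.equivMapOfInjective _ (injective_mulVecLin_of_mul_eq_one hKJ) _).finrank_eq.symm

theorem aeval_mul_of_intertwine {A : Matrix (Fin n) (Fin n) ℝ} {B : Matrix (Fin m) (Fin m) ℝ}
    {J : Matrix (Fin n) (Fin m) ℝ} (h : A * J = J * B) (q : ℝ[X]) :
    aeval A q * J = J * aeval B q := by
  induction q using Polynomial.induction_on' with
  | add q r hq hr => rw [map_add, map_add, Matrix.add_mul, hq, hr, Matrix.mul_add]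
  | monomial k a =>
    rw [aeval_monomial, aeval_monomial, ← Algebra.smul_def, ← Algebra.smul_def, Matrix.smul_mul,
      Matrix.mul_smul]
    congr 1
    induction k with
    | zero => simp
    | succ k ih =>
      rw [pow_succ, pow_succ, Matrix.mul_assoc, h, ← Matrix.mul_assoc, ih, Matrix.mul_assoc]

theorem isCoprime_of_no_common_root {p q : ℝ[X]}
    (h : ∀ z : ℂ, aeval z p = 0 → aeval z q = 0 → False) : IsCoprime p q := by
  refine (Polynomial.isCoprime_iff_aeval_ne_zero_of_isAlgClosed ℝ ℂ p q).2 fun z => ?_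
  by_contra! hz
  exact h z hz.1 hz.2

theorem mem_eigenvalues_iff {A : Matrix (Fin n) (Fin n) ℝ} {z : ℂ} :
    z ∈ eigenvalues A ↔ aeval z A.charpoly = 0 := by
  rw [eigenvalues, Matrix.mem_spectrum_iff_isRoot_charpoly, Matrix.charpoly_map, IsRoot.def,
    eval_map_algebraMap]

variable {a b c : ℕ}

/-- The spectral projections preserve the unobservable subspace. -/
theorem mulVec_mem_unobservable_block {A : Matrix (Fin n) (Fin n) ℝ}
    {C : Matrix (Fin p) (Fin n) ℝ}
    {B : Matrix (Fin a) (Fin a) ℝ} {B₁ : Matrix (Fin b) (Fin b) ℝ} {B₂ : Matrix (Fin c) (Fin c) ℝ}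
    {J : Matrix (Fin n) (Fin a) ℝ} {J₁ : Matrix (Fin n) (Fin b) ℝ} {J₂ : Matrix (Fin n) (Fin c) ℝ}
    {K : Matrix (Fin a) (Fin n) ℝ} {K₁ : Matrix (Fin b) (Fin n) ℝ} {K₂ : Matrix (Fin c) (Fin n) ℝ}
    (hsum : J * K + J₁ * K₁ + J₂ * K₂ = 1) (hJ : A * J = J * B) (hJ₁ : A * J₁ = J₁ * B₁)
    (hJ₂ : A * J₂ = J₂ * B₂) (h₁ : ∀ z ∈ eigenvalues B, z ∉ eigenvalues B₁)
    (h₂ : ∀ z ∈ eigenvalues B, z ∉ eigenvalues B₂) {x : Fin n → ℝ} (hx : x ∈ unobservable A C) :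
    K *ᵥ x ∈ unobservable B (C * J) := by
  have hcop : IsCoprime B.charpoly (B₁.charpoly * B₂.charpoly) := by
    refine isCoprime_of_no_common_root fun z hz hz' => ?_
    rw [← mem_eigenvalues_iff] at hz
    rw [map_mul, mul_eq_zero, ← mem_eigenvalues_iff, ← mem_eigenvalues_iff] at hz'
    exact hz'.elim (h₁ z hz) (h₂ z hz)
  obtain ⟨u, v, huv⟩ := hcop
  -- By Bézout `s` is 1 modulo the characteristic polynomial of `B` and 0 modulo the other two.
  -- Hence `aeval A s` is the projection `J * K`, and polynomials in `A` preserve the unobservable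
  -- subspace.
  set s : ℝ[X] := v * (B₁.charpoly * B₂.charpoly) with hs
  have hsB : aeval B s = 1 := by
    rw [← eq_sub_iff_add_eq'] at huv
    rw [huv]
    simp [Matrix.aeval_self_charpoly]
  have hsB₁ : aeval B₁ s = 0 := by simp [hs, Matrix.aeval_self_charpoly]
  have hsB₂ : aeval B₂ s = 0 := by simp [hs, Matrix.aeval_self_charpoly]
  have hproj : aeval A s = J * K := by
    rw [← Matrix.mul_one (aeval A s), ← hsum, Matrix.mul_add, Matrix.mul_add,
      ← Matrix.mul_assoc, ← Matrix.mul_assoc, ← Matrix.mul_assoc, aeval_mul_of_intertwine hJ,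
      aeval_mul_of_intertwine hJ₁, aeval_mul_of_intertwine hJ₂, hsB, hsB₁, hsB₂]
    simp
  have hmem := aeval_mulVec_mem_unobservable hx s
  rw [hproj, ← mulVec_mulVec] at hmem
  rw [← comap_unobservable hJ]
  exact hmem

end Unobservable

namespace SpectralForm

variable {n p : ℕ} {A : Matrix (Fin n) (Fin n) ℝ} {C : Matrix (Fin p) (Fin n) ℝ}
  (D : SpectralForm A C)

/-- Cutting `P` into columns and `Q` into rows gives the inclusions and projections of the three
blocks, with no sum-type indices left. -/
theorem exists_blocks : ∃ (J₀ : Matrix (Fin n) (Fin D.nZero) ℝ)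
    (J₁ : Matrix (Fin n) (Fin D.nPlus) ℝ) (J₂ : Matrix (Fin n) (Fin D.nMinus) ℝ)
    (K₀ : Matrix (Fin D.nZero) (Fin n) ℝ) (K₁ : Matrix (Fin D.nPlus) (Fin n) ℝ)
    (K₂ : Matrix (Fin D.nMinus) (Fin n) ℝ),
    J₀ * K₀ + J₁ * K₁ + J₂ * K₂ = 1 ∧
    (K₀ * J₀ = 1 ∧ K₀ * J₁ = 0 ∧ K₀ * J₂ = 0 ∧ K₁ * J₀ = 0 ∧ K₁ * J₁ = 1 ∧ K₁ * J₂ = 0 ∧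
      K₂ * J₀ = 0 ∧ K₂ * J₁ = 0 ∧ K₂ * J₂ = 1) ∧
    (A * J₀ = J₀ * D.AZero ∧ A * J₁ = J₁ * D.APlus ∧ A * J₂ = J₂ * D.AMinus) ∧
    (K₀ * A = D.AZero * K₀ ∧ K₁ * A = D.APlus * K₁ ∧ K₂ * A = D.AMinus * K₂) ∧
    (C * J₀ = D.CZero ∧ C * J₁ = D.CPlus ∧ C * J₂ = D.CMinus) := by
  obtain ⟨J₀, J', hJ⟩ : ∃ J₀ J', D.P = fromCols J₀ J' := ⟨_, _, (fromCols_toCols D.P).symm⟩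
  obtain ⟨J₁, J₂, rfl⟩ : ∃ J₁ J₂, J' = fromCols J₁ J₂ := ⟨_, _, (fromCols_toCols J').symm⟩
  obtain ⟨K₀, K', hK⟩ : ∃ K₀ K', D.Q = fromRows K₀ K' := ⟨_, _, (fromRows_toRows D.Q).symm⟩
  obtain ⟨K₁, K₂, rfl⟩ : ∃ K₁ K₂, K' = fromRows K₁ K₂ := ⟨_, _, (fromRows_toRows K').symm⟩
  have h1 := D.mul_inv
  have h2 := D.inv_mul
  have h3 : A * D.P = D.P * fromBlocks D.AZero 0 0 (fromBlocks D.APlus 0 0 D.AMinus) := by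
    rw [← D.conj_eq, ← Matrix.mul_assoc, ← Matrix.mul_assoc, D.mul_inv, Matrix.one_mul]
  have h4 : D.Q * A = fromBlocks D.AZero 0 0 (fromBlocks D.APlus 0 0 D.AMinus) * D.Q := by
    rw [← D.conj_eq, Matrix.mul_assoc, D.mul_inv, Matrix.mul_one]
  have h5 := D.obs_eq
  rw [hJ, hK, fromCols_mul_fromRows, fromCols_mul_fromRows, ← add_assoc] at h1
  rw [hJ, hK, fromRows_mul_fromCols, mul_fromCols, fromRows_mul, fromRows_mul_fromCols,
    ← fromBlocks_one, ← fromBlocks_one] at h2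
  rw [hJ, mul_fromCols, mul_fromCols, fromCols_mul_fromBlocks, fromCols_mul_fromBlocks] at h3
  rw [hK, fromRows_mul, fromRows_mul, fromBlocks_mul_fromRows, fromBlocks_mul_fromRows] at h4
  rw [hJ, mul_fromCols, mul_fromCols, fromCols_ext_iff, fromCols_ext_iff] at h5
  refine ⟨J₀, J₁, J₂, K₀, K₁, K₂, h1, ?_, ?_, ?_, h5⟩
  · obtain ⟨h00, h0', h'0, h'⟩ := fromBlocks_inj.1 h2
    obtain ⟨h11, h12, h21, h22⟩ := fromBlocks_inj.1 h'
    rw [← fromCols_zero, fromCols_ext_iff] at h0'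
    rw [← fromRows_zero, fromRows_ext_iff] at h'0
    exact ⟨h00, h0'.1, h0'.2, h'0.1, h11, h12, h'0.2, h21, h22⟩
  · simpa [fromCols_ext_iff] using h3
  · simpa [fromRows_ext_iff] using h4

theorem finrank_stableSubspace : Module.finrank ℝ (stableSubspace A) = D.nMinus ∧
    Module.finrank ℝ (stableSubspace (-A)) = D.nPlus ∧
    Module.finrank ℝ ↥(unobservable A C ⊓ stableSubspace A) =
      Module.finrank ℝ (unobservable D.AMinus D.CMinus) ∧
    Module.finrank ℝ ↥(unobservable A C ⊓ stableSubspace (-A)) =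
      Module.finrank ℝ (unobservable D.APlus D.CPlus) := by
  obtain ⟨J₀, J₁, J₂, K₀, K₁, K₂, hsum, ⟨h00, -, -, -, h11, -, -, -, h22⟩, ⟨hJ₀, hJ₁, hJ₂⟩,
    ⟨hK₀, hK₁, hK₂⟩, hC₀, hC₁, hC₂⟩ := D.exists_blocks
  have hminus : stableSubspace A = LinearMap.range J₂.mulVecLin :=
    stableSubspace_eq_range (by rw [← hsum]; abel) hJ₂ hK₀ hK₁ D.re_neg
      (fun μ hμ => (D.re_zero μ hμ).ge) (fun μ hμ => (D.re_pos μ hμ).le)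
  -- Negating `A` reverses the signs of the real parts, so the positive block becomes the stable
  -- one.
  have hplus : stableSubspace (-A) = LinearMap.range J₁.mulVecLin := by
    refine stableSubspace_eq_range (B := -D.APlus) (B₁ := -D.AZero) (B₂ := -D.AMinus)
      (K := K₁) (J₁ := J₀) (J₂ := J₂) (K₁ := K₀) (K₂ := K₂) (by rw [← hsum]; abel)
      (by simp [hJ₁]) (by simp [hK₀]) (by simp [hK₂]) ?_ ?_ ?_
    · intro μ hμ
      simpa using D.re_pos _ (mem_eigenvalues_neg.1 hμ)
    · intro μ hμ
      simpa using (D.re_zero _ (mem_eigenvalues_neg.1 hμ)).le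
    · intro μ hμ
      simpa using (D.re_neg _ (mem_eigenvalues_neg.1 hμ)).le
  rw [hminus, hplus, finrank_unobservable_inf_range h22 hJ₂, finrank_unobservable_inf_range h11 hJ₁,
    hC₁, hC₂, LinearMap.finrank_range_of_inj (injective_mulVecLin_of_mul_eq_one h22),
    LinearMap.finrank_range_of_inj (injective_mulVecLin_of_mul_eq_one h11)]
  simp

theorem nZero_add_nPlus_add_nMinus : D.nZero + D.nPlus + D.nMinus = n := by
  let e := Matrix.toLin'OfInv D.inv_mul D.mul_inv
  have := e.finrank_eq
  simp at this
  omega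

/-- Both the spectral projections and the block inclusions respect unobservability, so the
unobservable subspace is the direct sum of those of the blocks. -/
theorem finrank_unobservable : Module.finrank ℝ (unobservable A C) =
    Module.finrank ℝ (unobservable D.AZero D.CZero) +
    Module.finrank ℝ (unobservable D.APlus D.CPlus) +
    Module.finrank ℝ (unobservable D.AMinus D.CMinus) := by
  obtain ⟨J₀, J₁, J₂, K₀, K₁, K₂, hsum, ⟨h00, h01, h02, h10, h11, h12, h20, h21, h22⟩,
    ⟨hJ₀, hJ₁, hJ₂⟩, -, hC₀, hC₁, hC₂⟩ := D.exists_blocks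
  have hd01 : ∀ z ∈ eigenvalues D.AZero, z ∉ eigenvalues D.APlus := fun z h0 h1 =>
    (D.re_pos z h1).ne' (D.re_zero z h0)
  have hd02 : ∀ z ∈ eigenvalues D.AZero, z ∉ eigenvalues D.AMinus := fun z h0 h2 =>
    (D.re_neg z h2).ne (D.re_zero z h0)
  have hd12 : ∀ z ∈ eigenvalues D.APlus, z ∉ eigenvalues D.AMinus := fun z h1 h2 =>
    (D.re_neg z h2).not_gt (D.re_pos z h1)
  have hN₀ : ∀ x ∈ unobservable A C, K₀ *ᵥ x ∈ unobservable D.AZero D.CZero := fun x hx => by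
    rw [← hC₀]
    exact mulVec_mem_unobservable_block hsum hJ₀ hJ₁ hJ₂ hd01 hd02 hx
  have hN₁ : ∀ x ∈ unobservable A C, K₁ *ᵥ x ∈ unobservable D.APlus D.CPlus := fun x hx => by
    rw [← hC₁]
    exact mulVec_mem_unobservable_block (J₁ := J₀) (K₁ := K₀) (by rw [← hsum]; abel) hJ₁ hJ₀ hJ₂
      (fun z h1 h0 => hd01 z h0 h1) hd12 hx
  have hN₂ : ∀ x ∈ unobservable A C, K₂ *ᵥ x ∈ unobservable D.AMinus D.CMinus := fun x hx => by
    rw [← hC₂]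
    exact mulVec_mem_unobservable_block (J₁ := J₀) (K₁ := K₀) (by rw [← hsum]; abel) hJ₂ hJ₀ hJ₁
      (fun z h2 h0 => hd02 z h0 h2) (fun z h2 h1 => hd12 z h1 h2) hx
  have hM₀ : ∀ y ∈ unobservable D.AZero D.CZero, J₀ *ᵥ y ∈ unobservable A C := fun y hy => by
    rwa [← hC₀, ← comap_unobservable hJ₀] at hy
  have hM₁ : ∀ y ∈ unobservable D.APlus D.CPlus, J₁ *ᵥ y ∈ unobservable A C := fun y hy => by
    rwa [← hC₁, ← comap_unobservable hJ₁] at hy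
  have hM₂ : ∀ y ∈ unobservable D.AMinus D.CMinus, J₂ *ᵥ y ∈ unobservable A C := fun y hy => by
    rwa [← hC₂, ← comap_unobservable hJ₂] at hy
  let e : unobservable A C ≃ₗ[ℝ] unobservable D.AZero D.CZero ×
      (unobservable D.APlus D.CPlus × unobservable D.AMinus D.CMinus) :=
    { toFun := fun x => (⟨K₀ *ᵥ x, hN₀ x x.2⟩, ⟨K₁ *ᵥ x, hN₁ x x.2⟩, ⟨K₂ *ᵥ x, hN₂ x x.2⟩)
      map_add' := fun x y => by ext : 3 <;> simp [mulVec_add]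
      map_smul' := fun r x => by ext : 3 <;> simp [mulVec_smul]
      invFun := fun y => ⟨J₀ *ᵥ y.1 + J₁ *ᵥ y.2.1 + J₂ *ᵥ y.2.2, Submodule.add_mem _
        (Submodule.add_mem _ (hM₀ _ y.1.2) (hM₁ _ y.2.1.2)) (hM₂ _ y.2.2.2)⟩
      left_inv := fun x => by
        ext1
        simp only [mulVec_mulVec, ← add_mulVec, hsum, one_mulVec]
      right_inv := fun y => by
        ext : 3 <;> simp [mulVec_add, mulVec_mulVec, h00, h01, h02, h10, h11, h12, h20, h21, h22] }
  rw [e.finrank_eq, Module.finrank_prod, Module.finrank_prod, add_assoc]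

end SpectralForm

end ObservedODE

end Observability

/-! ### Existence of the spectral form. -/

section SpectralDecomposition

open Set Filter Matrix Polynomial

namespace ObservedODE

section Existence

variable {n p : ℕ}

/-- The roots are Galois conjugate over `ℝ`, and the only automorphisms of `ℂ` over `ℝ` are the
identity and conjugation. -/
theorem re_eq_of_irreducible {q : ℝ[X]} (hq : Irreducible q) {z w : ℂ} (hz : aeval z q = 0)
    (hw : aeval w q = 0) : z.re = w.re := by
  have h : IsConjRoot ℝ z w :=
    (minpoly.eq_of_irreducible hq hz).symm.trans (minpoly.eq_of_irreducible hq hw)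
  have : Normal ℝ ℂ := normal_iff.2 fun x =>
    ⟨Algebra.IsIntegral.isIntegral x, IsAlgClosed.splits _⟩
  obtain ⟨σ, rfl⟩ := isConjRoot_iff_exists_algEquiv.1 h
  rcases Complex.real_algHom_eq_id_or_conj (σ : ℂ →ₐ[ℝ] ℂ) with h | h
  · exact congrArg Complex.re (DFunLike.congr_fun h w)
  · exact (congrArg Complex.re (DFunLike.congr_fun h w)).trans (Complex.conj_re w)

/-- A real polynomial splits into three factors according to the sign of the real parts
of its complex roots. -/
theorem exists_mul_mul_eq_of_re (q : ℝ[X]) (hq : q ≠ 0) : ∃ q₀ q₁ q₂ : ℝ[X],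
    q = q₀ * (q₁ * q₂) ∧ (∀ z : ℂ, aeval z q₀ = 0 → z.re = 0) ∧
    (∀ z : ℂ, aeval z q₁ = 0 → 0 < z.re) ∧ (∀ z : ℂ, aeval z q₂ = 0 → z.re < 0) := by
  induction q using WfDvdMonoid.induction_on_irreducible with
  | zero => exact absurd rfl hq
  | unit u hu =>
    refine ⟨u, 1, 1, by simp, fun z hz => ?_, fun z hz => ?_, fun z hz => ?_⟩
    · exact absurd hz (hu.map (aeval z)).ne_zero
    · simp at hz
    · simp at hz
  | mul a i ha hi ih =>
    obtain ⟨q₀, q₁, q₂, rfl, h₀, h₁, h₂⟩ := ih ha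
    obtain ⟨w, hw⟩ : ∃ w : ℂ, aeval w i = 0 :=
      IsAlgClosed.exists_aeval_eq_zero ℂ i (degree_pos_of_irreducible hi).ne'
    have key : ∀ z : ℂ, aeval z i = 0 → z.re = w.re := fun z hz => re_eq_of_irreducible hi hz hw
    rcases lt_trichotomy w.re 0 with hneg | hzero | hpos
    · refine ⟨q₀, q₁, i * q₂, by ring, h₀, h₁, fun z hz => ?_⟩
      rw [map_mul, mul_eq_zero] at hz
      exact hz.elim (fun h => (key z h).trans_lt hneg) (h₂ z)
    · refine ⟨i * q₀, q₁, q₂, by ring, fun z hz => ?_, h₁, h₂⟩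
      rw [map_mul, mul_eq_zero] at hz
      exact hz.elim (fun h => (key z h).trans hzero) (h₀ z)
    · refine ⟨q₀, i * q₁, q₂, by ring, h₀, fun z hz => ?_, h₂⟩
      rw [map_mul, mul_eq_zero] at hz
      exact hz.elim (fun h => hpos.trans_eq (key z h).symm) (h₁ z)

/-- Spectral mapping puts `q(μ)` in the spectrum of `q(B) = 0`. The zero-size block is separate: its
matrix ring is trivial and its spectrum empty. -/
theorem aeval_eq_zero_of_mem_eigenvalues {B : Matrix (Fin n) (Fin n) ℝ} {q : ℝ[X]}
    (hq : aeval B q = 0) {μ : ℂ} (hμ : μ ∈ eigenvalues B) : aeval μ q = 0 := by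
  rcases subsingleton_or_nontrivial (Matrix (Fin n) (Fin n) ℂ) with hs | hs
  · rw [eigenvalues, spectrum.of_subsingleton] at hμ
    exact hμ.elim
  have h1 := spectrum.subset_polynomial_aeval (B.map (algebraMap ℝ ℂ)) (q.map (algebraMap ℝ ℂ))
    ⟨μ, hμ, rfl⟩
  have h2 : aeval (B.map (algebraMap ℝ ℂ)) q = 0 := by
    have := aeval_algHom_apply ((Algebra.ofId ℝ ℂ).mapMatrix (m := Fin n)) B q
    rw [hq, map_zero] at this
    exact this
  rw [aeval_map_algebraMap, h2, spectrum.zero_eq, mem_singleton_iff] at h1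
  simpa [eval_map_algebraMap] using h1

theorem coe_aeval_restrict {V : Type*} [AddCommGroup V] [Module ℝ V] (f : Module.End ℝ V)
    {U : Submodule ℝ V} (hU : ∀ x ∈ U, f x ∈ U) (q : ℝ[X]) (x : U) :
    ((aeval (f.restrict hU) q x : U) : V) = aeval f q (x : V) := by
  induction q using Polynomial.induction_on' with
  | add q r hq hr => simp [hq, hr]
  | monomial k a =>
    rw [aeval_monomial, aeval_monomial, ← Algebra.smul_def, ← Algebra.smul_def,
      Module.End.pow_restrict]
    rfl

theorem mem_eigenvalues_restrict_ker {V : Type*} [AddCommGroup V] [Module ℝ V]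
    (f : Module.End ℝ V) {q : ℝ[X]} {m : ℕ}
    (hU : ∀ x ∈ LinearMap.ker (aeval f q), f x ∈ LinearMap.ker (aeval f q))
    (b : Module.Basis (Fin m) ℝ (LinearMap.ker (aeval f q))) {μ : ℂ}
    (hμ : μ ∈ eigenvalues (LinearMap.toMatrix b b (f.restrict hU))) : aeval μ q = 0 := by
  refine aeval_eq_zero_of_mem_eigenvalues ?_ hμ
  have h0 : aeval (f.restrict hU) q = 0 := by
    ext x
    rw [coe_aeval_restrict]
    exact x.2
  have := aeval_algHom_apply (LinearMap.toMatrixAlgEquiv b).toAlgHom (f.restrict hU) q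
  rw [h0, map_zero] at this
  exact this

/-- Primary decomposition: the characteristic polynomial factors into coprime parts by the sign of
the real part, and the kernels of these parts at `f` are invariant with direct sum the whole space.
Bases of the three kernels give `P`. -/
theorem nonempty_spectralForm (A : Matrix (Fin n) (Fin n) ℝ) (C : Matrix (Fin p) (Fin n) ℝ) :
    Nonempty (SpectralForm A C) := by
  obtain ⟨q₀, q₁, q₂, hq, h₀, h₁, h₂⟩ := exists_mul_mul_eq_of_re A.charpoly A.charpoly_monic.ne_zero
  set f : Module.End ℝ (Fin n → ℝ) := Matrix.toLin' A with hf
  have hinv : ∀ q : ℝ[X], ∀ x ∈ LinearMap.ker (aeval f q), f x ∈ LinearMap.ker (aeval f q) := by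
    intro q x hx
    rw [LinearMap.mem_ker] at hx ⊢
    have : Commute (aeval f q) f := by
      simpa using (Commute.all q X).map (aeval f)
    rw [← Module.End.mul_apply, this.eq, Module.End.mul_apply, hx, map_zero]
  have hc12 : IsCoprime q₁ q₂ := isCoprime_of_no_common_root fun z hz hz' =>
    (h₁ z hz).not_gt (h₂ z hz')
  have hc0 : IsCoprime q₀ (q₁ * q₂) := isCoprime_of_no_common_root fun z hz hz' => by
    rw [map_mul, mul_eq_zero] at hz'
    exact hz'.elim (fun h => (h₁ z h).ne' (h₀ z hz)) (fun h => (h₂ z h).ne (h₀ z hz))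
  set U₀ := LinearMap.ker (aeval f q₀)
  set U₁ := LinearMap.ker (aeval f q₁)
  set U₂ := LinearMap.ker (aeval f q₂)
  have hsup12 : U₁ ⊔ U₂ = LinearMap.ker (aeval f (q₁ * q₂)) :=
    sup_ker_aeval_eq_ker_aeval_mul_of_coprime f hc12
  have hsup : U₀ ⊔ (U₁ ⊔ U₂) = ⊤ := by
    rw [hsup12, sup_ker_aeval_eq_ker_aeval_mul_of_coprime f hc0, ← hq, LinearMap.ker_eq_top]
    have := aeval_algHom_apply (Matrix.toLinAlgEquiv' (R := ℝ) (n := Fin n)).toAlgHom A A.charpoly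
    rw [A.aeval_self_charpoly, map_zero] at this
    exact this
  have hdisj12 : Disjoint U₁ U₂ := disjoint_ker_aeval_of_isCoprime f hc12
  have hdisj : Disjoint U₀ (U₁ ⊔ U₂) := by
    rw [hsup12]
    exact disjoint_ker_aeval_of_isCoprime f hc0
  let g : U₀ × (U₁ × U₂) →ₗ[ℝ] (Fin n → ℝ) :=
    U₀.subtype.coprod (U₁.subtype.coprod U₂.subtype)
  have hg : Function.Bijective g := by
    constructor
    · rw [← LinearMap.ker_eq_bot, eq_bot_iff]
      rintro ⟨x, y, z⟩ hxyz
      have h : (x : Fin n → ℝ) + (y + z) = 0 := hxyz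
      have hx : (x : Fin n → ℝ) = 0 := Submodule.disjoint_def.1 hdisj x x.2 (by
        rw [eq_neg_of_add_eq_zero_left h]
        exact Submodule.neg_mem _ (Submodule.add_mem_sup y.2 z.2))
      rw [hx, zero_add] at h
      have hy : (y : Fin n → ℝ) = 0 := Submodule.disjoint_def.1 hdisj12 y y.2 (by
        rw [eq_neg_of_add_eq_zero_left h]
        exact Submodule.neg_mem _ z.2)
      rw [hy, zero_add] at h
      simp only [Submodule.mem_bot, Prod.mk_eq_zero]
      exact ⟨Subtype.ext hx, Subtype.ext hy, Subtype.ext h⟩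
    · intro v
      have hv : v ∈ U₀ ⊔ (U₁ ⊔ U₂) := hsup ▸ Submodule.mem_top
      obtain ⟨x, hx, w, hw, rfl⟩ := Submodule.mem_sup.1 hv
      obtain ⟨y, hy, z, hz, rfl⟩ := Submodule.mem_sup.1 hw
      exact ⟨(⟨x, hx⟩, ⟨y, hy⟩, ⟨z, hz⟩), rfl⟩
  let e := LinearEquiv.ofBijective g hg
  let b₀ := Module.finBasis ℝ U₀
  let b₁ := Module.finBasis ℝ U₁
  let b₂ := Module.finBasis ℝ U₂
  let b := (b₀.prod (b₁.prod b₂)).map e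
  let P := (Pi.basisFun ℝ (Fin n)).toMatrix b
  have hrepr : ∀ x y z i, b.repr ((x : U₀) + ((y : U₁) + (z : U₂)) : Fin n → ℝ) i =
      (b₀.prod (b₁.prod b₂)).repr (x, y, z) i := by
    intro x y z i
    have : ((x : Fin n → ℝ) + (y + z)) = e (x, y, z) := rfl
    rw [this]
    simp [b]
  refine ⟨{
    nZero := _, nPlus := _, nMinus := _
    AZero := LinearMap.toMatrix b₀ b₀ (f.restrict (hinv q₀))
    APlus := LinearMap.toMatrix b₁ b₁ (f.restrict (hinv q₁))
    AMinus := LinearMap.toMatrix b₂ b₂ (f.restrict (hinv q₂))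
    CZero := (C * P).toCols₁
    CPlus := (C * P).toCols₂.toCols₁
    CMinus := (C * P).toCols₂.toCols₂
    P := P
    Q := b.toMatrix (Pi.basisFun ℝ (Fin n))
    mul_inv := Module.Basis.toMatrix_mul_toMatrix_flip _ _
    inv_mul := Module.Basis.toMatrix_mul_toMatrix_flip _ _
    conj_eq := ?_
    obs_eq := by rw [fromCols_toCols, fromCols_toCols]
    re_zero := fun μ hμ => h₀ μ (mem_eigenvalues_restrict_ker f (hinv q₀) b₀ hμ)
    re_pos := fun μ hμ => h₁ μ (mem_eigenvalues_restrict_ker f (hinv q₁) b₁ hμ)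
    re_neg := fun μ hμ => h₂ μ (mem_eigenvalues_restrict_ker f (hinv q₂) b₂ hμ) }⟩
  have hA : A = LinearMap.toMatrix (Pi.basisFun ℝ (Fin n)) (Pi.basisFun ℝ (Fin n)) f := by
    rw [hf, LinearMap.toMatrix_eq_toMatrix', LinearMap.toMatrix'_toLin']
  conv_lhs => rw [hA]
  rw [basis_toMatrix_mul_linearMap_toMatrix_mul_basis_toMatrix]
  ext i j
  rw [LinearMap.toMatrix_apply]
  rcases j with j | j | j
  · have hj : f (b (Sum.inl j)) = (f.restrict (hinv q₀) (b₀ j) : U₀) + ((0 : U₁) + (0 : U₂)) := by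
      simp [b, e, g]
    rw [hj, hrepr]
    rcases i with i | i | i <;> simp [LinearMap.toMatrix_apply]
  · have hj : f (b (Sum.inr (Sum.inl j))) =
        (0 : U₀) + ((f.restrict (hinv q₁) (b₁ j) : U₁) + (0 : U₂)) := by
      simp [b, e, g]
    rw [hj, hrepr]
    rcases i with i | i | i <;> simp [LinearMap.toMatrix_apply]
  · have hj : f (b (Sum.inr (Sum.inr j))) =
        (0 : U₀) + ((0 : U₁) + (f.restrict (hinv q₂) (b₂ j) : U₂)) := by
      simp [b, e, g]
    rw [hj, hrepr]
    rcases i with i | i | i <;> simp [LinearMap.toMatrix_apply]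

end Existence

end ObservedODE

end SpectralDecomposition

/-! ### Subspaces preserved by a topological equivalence, and the invariants. -/

section TopologicalInvariants

open Set Filter Matrix

open scoped Topology

namespace ObservedODE

section Equivalence

variable {n p : ℕ} {A₁ A₂ : Matrix (Fin n) (Fin n) ℝ} {C₁ C₂ : Matrix (Fin p) (Fin n) ℝ}

/-- A topological equivalence can be normalized to fix the origin; it then intertwines the flows
and the observations. -/
theorem TopologicallyEquivalent.exists_homeomorph
    (h : TopologicallyEquivalent A₁ C₁ A₂ C₂) :
    ∃ H : (Fin n → ℝ) ≃ₜ (Fin n → ℝ), H 0 = 0 ∧ (∀ t x, H (flow A₁ t x) = flow A₂ t (H x)) ∧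
      ∀ x, C₂ *ᵥ H x = C₁ *ᵥ x := by
  obtain ⟨H, hH, -⟩ := h
  have hnonneg : ∀ t, 0 ≤ t → ∀ x, H (flow A₁ t x) = flow A₂ t (H x) := by
    intro t ht x
    have := eq_flow_of_hasDerivWithinAt (hH _ _ (isTrajectory_flow A₁ C₁ x)).1 ht
    rwa [flow_zero] at this
  have hflow : ∀ t x, H (flow A₁ t x) = flow A₂ t (H x) := by
    intro t x
    rcases le_total 0 t with ht | ht
    · exact hnonneg t ht x
    -- Negative times follow by flowing forward from `flow A₁ t x` for time `-t`.
    · have h1 := hnonneg (-t) (neg_nonneg.2 ht) (flow A₁ t x)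
      have h2 := flow_flow_neg A₁ (-t) x
      rw [neg_neg] at h2
      rw [h2] at h1
      rw [h1, flow_flow_neg]
  have hobs : ∀ x, C₂ *ᵥ H x = C₁ *ᵥ x := by
    intro x
    have := (hH _ _ (isTrajectory_flow A₁ C₁ x)).2 0 self_mem_Ici
    simp only [flow_zero] at this
    exact this.symm
  -- `H 0` is an equilibrium since the origin is, so translating by it commutes with the second
  -- flow.
  have hfix : ∀ t, flow A₂ t (-H 0) = -H 0 := by
    intro t
    have := hflow t 0
    rw [flow, flow, mulVec_zero] at this
    rw [flow, mulVec_neg, ← this]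
  refine ⟨H.trans (Homeomorph.addRight (-H 0)), ?_, fun t x => ?_, fun x => ?_⟩
  · simp
  · simp only [Homeomorph.trans_apply, Homeomorph.coe_addRight]
    rw [flow_add_vec, hfix, hflow]
  · simp only [Homeomorph.trans_apply, Homeomorph.coe_addRight]
    rw [mulVec_add, mulVec_neg, hobs, hobs, mulVec_zero, neg_zero, add_zero]

theorem finrank_eq_of_homeomorph_maps (H : (Fin n → ℝ) ≃ₜ (Fin n → ℝ))
    {U V : Submodule ℝ (Fin n → ℝ)} (h : ∀ x, x ∈ U ↔ H x ∈ V) :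
    Module.finrank ℝ U = Module.finrank ℝ V :=
  Homeomorph.finrank_eq (H.subtype h : {x // x ∈ U} ≃ₜ {x // x ∈ V})

/-- A homeomorphism fixing 0 preserves and reflects convergence of orbits to 0. -/
theorem mem_stableSubspace_iff_of_homeomorph {H : (Fin n → ℝ) ≃ₜ (Fin n → ℝ)} (h0 : H 0 = 0)
    {B₁ B₂ : Matrix (Fin n) (Fin n) ℝ} (hflow : ∀ t x, H (flow B₁ t x) = flow B₂ t (H x))
    (x : Fin n → ℝ) : x ∈ stableSubspace B₁ ↔ H x ∈ stableSubspace B₂ := by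
  rw [mem_stableSubspace, mem_stableSubspace, H.isEmbedding.tendsto_nhds_iff, h0]
  simp_rw [← hflow]
  rfl

theorem TopologicallyEquivalent.finrank_eq (h : TopologicallyEquivalent A₁ C₁ A₂ C₂) :
    Module.finrank ℝ (stableSubspace A₁) = Module.finrank ℝ (stableSubspace A₂) ∧
    Module.finrank ℝ (stableSubspace (-A₁)) = Module.finrank ℝ (stableSubspace (-A₂)) ∧
    Module.finrank ℝ (unobservable A₁ C₁) = Module.finrank ℝ (unobservable A₂ C₂) ∧
    Module.finrank ℝ ↥(unobservable A₁ C₁ ⊓ stableSubspace A₁) =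
      Module.finrank ℝ ↥(unobservable A₂ C₂ ⊓ stableSubspace A₂) ∧
    Module.finrank ℝ ↥(unobservable A₁ C₁ ⊓ stableSubspace (-A₁)) =
      Module.finrank ℝ ↥(unobservable A₂ C₂ ⊓ stableSubspace (-A₂)) := by
  obtain ⟨H, h0, hflow, hobs⟩ := h.exists_homeomorph
  have hminus := mem_stableSubspace_iff_of_homeomorph h0 hflow
  have hplus := mem_stableSubspace_iff_of_homeomorph (B₁ := -A₁) (B₂ := -A₂) h0 fun t x => by
    rw [flow_neg_matrix, flow_neg_matrix, hflow]
  have hun : ∀ x, x ∈ unobservable A₁ C₁ ↔ H x ∈ unobservable A₂ C₂ := by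
    intro x
    rw [mem_unobservable_iff_flow, mem_unobservable_iff_flow]
    simp_rw [← hflow, hobs]
  exact ⟨finrank_eq_of_homeomorph_maps H hminus, finrank_eq_of_homeomorph_maps H hplus,
    finrank_eq_of_homeomorph_maps H hun,
    finrank_eq_of_homeomorph_maps H fun x => and_congr (hun x) (hminus x),
    finrank_eq_of_homeomorph_maps H fun x => and_congr (hun x) (hplus x)⟩

theorem TopologicallyEquivalent.kObs_eq (h : TopologicallyEquivalent A₁ C₁ A₂ C₂) :
    kObs A₁ C₁ = kObs A₂ C₂ := by
  have h1 := kObs_add_finrank_unobservable A₁ C₁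
  have h2 := kObs_add_finrank_unobservable A₂ C₂
  have h3 := h.finrank_eq.2.2.1
  omega

/-- Only arithmetic remains: `nZero` is `n` minus the other two sizes, and the unobservable
dimension of the central block is the total minus those of the other two. -/
theorem TopologicallyEquivalent.spectralForm_eq (h : TopologicallyEquivalent A₁ C₁ A₂ C₂)
    (D₁ : SpectralForm A₁ C₁) (D₂ : SpectralForm A₂ C₂) :
    D₁.nZero = D₂.nZero ∧ D₁.nPlus = D₂.nPlus ∧ D₁.nMinus = D₂.nMinus ∧
      D₁.kObsZero = D₂.kObsZero ∧ D₁.kObsPlus = D₂.kObsPlus ∧ D₁.kObsMinus = D₂.kObsMinus := by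
  obtain ⟨hm, hp, hu, hum, hup⟩ := h.finrank_eq
  obtain ⟨hm₁, hp₁, hum₁, hup₁⟩ := D₁.finrank_stableSubspace
  obtain ⟨hm₂, hp₂, hum₂, hup₂⟩ := D₂.finrank_stableSubspace
  have hn₁ := D₁.nZero_add_nPlus_add_nMinus
  have hn₂ := D₂.nZero_add_nPlus_add_nMinus
  have hs₁ := D₁.finrank_unobservable
  have hs₂ := D₂.finrank_unobservable
  have ha₁ := kObs_add_finrank_unobservable D₁.AZero D₁.CZero
  have ha₂ := kObs_add_finrank_unobservable D₂.AZero D₂.CZero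
  have hb₁ := kObs_add_finrank_unobservable D₁.APlus D₁.CPlus
  have hb₂ := kObs_add_finrank_unobservable D₂.APlus D₂.CPlus
  have hc₁ := kObs_add_finrank_unobservable D₁.AMinus D₁.CMinus
  have hc₂ := kObs_add_finrank_unobservable D₂.AMinus D₂.CMinus
  unfold SpectralForm.kObsZero SpectralForm.kObsPlus SpectralForm.kObsMinus
  omega

end Equivalence

end ObservedODE

end TopologicalInvariants

theorem proposition1p2 {n p : ℕ}
    (A₁ A₂ : Matrix (Fin n) (Fin n) ℝ) (C₁ C₂ : Matrix (Fin p) (Fin n) ℝ)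
    (h : ObservedODE.TopologicallyEquivalent A₁ C₁ A₂ C₂) :
    Nonempty (ObservedODE.SpectralForm A₁ C₁) ∧ Nonempty (ObservedODE.SpectralForm A₂ C₂) ∧
    (∀ (D₁ : ObservedODE.SpectralForm A₁ C₁) (D₂ : ObservedODE.SpectralForm A₂ C₂),
      D₁.nZero = D₂.nZero ∧ D₁.nPlus = D₂.nPlus ∧ D₁.nMinus = D₂.nMinus ∧
      D₁.kObsZero = D₂.kObsZero ∧ D₁.kObsPlus = D₂.kObsPlus ∧ D₁.kObsMinus = D₂.kObsMinus) ∧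
    ObservedODE.kObs A₁ C₁ = ObservedODE.kObs A₂ C₂ ∧
    (ObservedODE.IsObservable A₁ C₁ ↔ ObservedODE.IsObservable A₂ C₂) ∧
    (ObservedODE.IsStable A₁ C₁ ↔ ObservedODE.IsStable A₂ C₂) := by
  obtain ⟨E₁⟩ := ObservedODE.nonempty_spectralForm A₁ C₁
  obtain ⟨E₂⟩ := ObservedODE.nonempty_spectralForm A₂ C₂
  refine ⟨⟨E₁⟩, ⟨E₂⟩, h.spectralForm_eq, h.kObs_eq, ?_, ?_, ?_⟩
  · rw [ObservedODE.IsObservable, ObservedODE.IsObservable, h.kObs_eq]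
  · rintro ⟨D, hD⟩
    exact ⟨E₂, (h.spectralForm_eq D E₂).2.2.1.symm.trans hD⟩
  · rintro ⟨D, hD⟩
    exact ⟨E₁, (h.spectralForm_eq E₁ D).2.2.1.trans hD⟩
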